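/- **Problem class.** Let $F_1,\dots,F_M:\mathbb R^d\to\mathbb R$ be the objectives of $M\ge 1$ machines, $F=\frac1M\sum_m F_m$, and let $S_m^\star=\arg\min F_m$. Machine $m$ can draw $z\sim\mathcal D_m$ and observe a stochastic gradient $g_m(x;z)$, jointly measurable in $(x,z)$, with $\mathbb E_{z\sim\mathcal D_m}[g_m(x;z)]=\nabla F_m(x)$. Let $B,\mu,H>0$, $Q,\zeta_\star,\phi_\star,\sigma_2,\sigma_4\ge 0$, $0\le\tau\le 2H$, and suppose: - each $F_m$ is $\mu$-strongly convex, $\nabla F_m$ is $H$-Lipschitz, $F_m$ is $C^2$ and $\nabla^2F_m$ is $Q$-Lipschitz in operator norm; - for $q\in\{2,4\}$ there are $\sigma_{q,m}\ge0$ with $\mathbb E_{z\sim\mathcal D_m}\|g_m(x;z)-\nabla F_m(x)\|^q\le\sigma_{q,m}^q$ for all $x,m$, and $\frac1M\sum_m\sigma_{q,m}^q\le\sigma_q^q$; - the minimizer $x^\star$ of $F$ satisfies $\|x^\star\|\le B$; - with $\zeta_{m,n}=\inf\{\|x-y\|:x\in S_m^\star,y\in S_n^\star\}$, $\frac1{M^2}\sum_{m,n}\zeta_{m,n}^4\le\zeta_\star^4$;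 and $\frac1M\sum_m\operatorname{dist}(x^\star,S_m^\star)^4\le\phi_\star^4$; - $\|\nabla^2F_m(x)-\nabla^2F_n(x)\|\le\tau$ for all $m,n,x$. **Algorithm.** Local SGD with $K\ge1$ local steps, $R\ge1$ rounds and step size $\eta$ starts at $x_0^m=0$. With independent $z_t^m\sim\mathcal D_m$ it sets $x_{t+1}^m=x_t^m-\eta g_m(x_t^m;z_t^m)$ if $K\nmid t+1$, and $x_{t+1}^m=\frac1M\sum_n\big(x_t^n-\eta g_n(x_t^n;z_t^n)\big)$ if $K\mid t+1$. Put $x_t=\frac1M\sum_m x_t^m$. **Rate.** Let $\kappa=H/\mu$, $\kappa'=2+\frac{4Q^2B^2}{\mu^2}+\frac{6H^4}{\mu^4}$, and $$\begin{aligned}S=\;&\frac{\sigma_2^2}{\mu^2MKR}+\frac{\sigma_4^4}{\mu^4K^3R^3M^2B^2}\\&+\kappa'\Big(\frac{\tau^2\phi_\star^2}{\mu^2R^2}+\frac{\tau^4\sigma_4^2\phi_\star^2}{\mu^6KR^5B^2}+\frac{\sigma_2^2\tau^2\phi_\star^2}{\mu^4KR^4B^2}+\frac{\tau^4\phi_\star^4}{\mu^4B^2R^4}+\frac{H^2\zeta_\star^2}{\mu^2R^2}+\frac{\tau^2\sigma_2^2}{\mu^4KR^3}\Big)\\&+\kappa'\Big(\frac{\sigma_2^2\ln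 K}{\mu^2KR^2}+\frac{H^4\zeta_\star^4}{\mu^4R^3B^2}+\frac{\tau^4\sigma_4^4}{\mu^8K^2R^5B^2}+\frac{\sigma_2^2H^2\zeta_\star^2}{\mu^4B^2R^4}+\frac{\tau^2\sigma_2^4}{\mu^6KR^5B^2}+\frac{\sigma_4^4\ln K}{\mu^4KB^2R^4}\Big).\end{aligned}$$ For a target accuracy $\epsilon_t>0$, let $\epsilon$ be the maximum of $\epsilon_t$ and of the fourteen summands of $S$ (those in the brackets multiplied by $\kappa'$), and let $\Lambda=\max\{1,\ln(B^2/\epsilon)\}$. **Theorem.** There are absolute constants $C>0$ and $q\in\mathbb N$ such that the following holds for all parameters as above and all $\epsilon_t>0$ with $$R\ \ge\ \frac{\tau\sqrt{\kappa'}}{\mu}\,\Lambda^2 .$$ There is a step size $\eta\in(0,\frac1{2H}]$, depending only on the parameters and on $\epsilon_t$, and equal to $\min\{\frac1{2H},\frac1{\mu KR}\ln\frac{B^2}{\epsilon}\}$ whenever $B^2>e\epsilon$, such that for every problem of the class (in any dimension) $x_{KR}$ has a finite fourth moment, $$\mathbb E\|x_{KR}-x^\star\|^2+\frac1{B^2}\mathbb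 E\|x_{KR}-x^\star\|^4\ \le\ C\Lambda^q\big(e^{-\eta\mu KR}B^2+S\big),$$ and, if $\epsilon_t\le e^{-KR/\kappa}B^2+S$, $$\mathbb E\|x_{KR}-x^\star\|^2+\frac1{B^2}\mathbb E\|x_{KR}-x^\star\|^4\ \le\ C\Lambda^q\big(e^{-KR/\kappa}B^2+S\big).$$ -/

import Mathlib

open MeasureTheory ProbabilityTheory

noncomputable section

namespace LocalSGD

/-- The parameter space `ℝ^d` with its Euclidean norm. -/
abbrev Space (d : ℕ) : Type := EuclideanSpace ℝ (Fin d)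

/-- The scalar parameters of the problem class and of the communication budget. -/
structure Params where
  /-- number of machines -/
  M : ℕ
  /-- number of local steps per communication round -/
  K : ℕ
  /-- number of communication rounds -/
  R : ℕ
  /-- bound on the norm of the optimum of the average objective -/
  B : ℝ
  /-- strong convexity -/
  μ : ℝ
  /-- second-order smoothness -/
  H : ℝ
  /-- third-order smoothness -/
  Q : ℝ
  /-- second-order heterogeneity -/
  τ : ℝ
  /-- discrepancy between the optima of the machines -/
  ζ : ℝ
  /-- discrepancy between the optima of the machines and of the average -/
  φ : ℝ
  /-- second moment of the gradient noise -/
  σ₂ : ℝ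
  /-- fourth moment of the gradient noise -/
  σ₄ : ℝ

/-- The ranges of the parameters. -/
structure Params.Admissible (p : Params) : Prop where
  M_pos : 0 < p.M
  K_pos : 0 < p.K
  R_pos : 0 < p.R
  B_pos : 0 < p.B
  μ_pos : 0 < p.μ
  H_pos : 0 < p.H
  Q_nonneg : 0 ≤ p.Q
  τ_nonneg : 0 ≤ p.τ
  τ_le : p.τ ≤ 2 * p.H
  ζ_nonneg : 0 ≤ p.ζ
  φ_nonneg : 0 ≤ p.φ
  σ₂_nonneg : 0 ≤ p.σ₂
  σ₄_nonneg : 0 ≤ p.σ₄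

/-- The condition number `κ = H / μ`. -/
def Params.κ (p : Params) : ℝ := p.H / p.μ

/-- `κ' = 2 + 4 Q² B² / μ² + 6 H⁴ / μ⁴`. -/
def Params.κ' (p : Params) : ℝ :=
  2 + 4 * p.Q ^ 2 * p.B ^ 2 / p.μ ^ 2 + 6 * p.H ^ 4 / p.μ ^ 4

/-- The terms of the rate other than the exponentially decaying one. -/
def Params.rateTerms (p : Params) : List ℝ :=
  let M : ℝ := p.M
  let K : ℝ := p.K
  let R : ℝ := p.R
  [ p.σ₂ ^ 2 / (p.μ ^ 2 * M * K * R),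
    p.σ₄ ^ 4 / (p.μ ^ 4 * K ^ 3 * R ^ 3 * M ^ 2 * p.B ^ 2),
    p.κ' * (p.τ ^ 2 * p.φ ^ 2 / (p.μ ^ 2 * R ^ 2)),
    p.κ' * (p.τ ^ 4 * p.σ₄ ^ 2 * p.φ ^ 2 / (p.μ ^ 6 * K * R ^ 5 * p.B ^ 2)),
    p.κ' * (p.σ₂ ^ 2 * p.τ ^ 2 * p.φ ^ 2 / (p.μ ^ 4 * K * R ^ 4 * p.B ^ 2)),
    p.κ' * (p.τ ^ 4 * p.φ ^ 4 / (p.μ ^ 4 * p.B ^ 2 * R ^ 4)),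
    p.κ' * (p.H ^ 2 * p.ζ ^ 2 / (p.μ ^ 2 * R ^ 2)),
    p.κ' * (p.τ ^ 2 * p.σ₂ ^ 2 / (p.μ ^ 4 * K * R ^ 3)),
    p.κ' * (p.σ₂ ^ 2 * Real.log K / (p.μ ^ 2 * K * R ^ 2)),
    p.κ' * (p.H ^ 4 * p.ζ ^ 4 / (p.μ ^ 4 * R ^ 3 * p.B ^ 2)),
    p.κ' * (p.τ ^ 4 * p.σ₄ ^ 4 / (p.μ ^ 8 * K ^ 2 * R ^ 5 * p.B ^ 2)),
    p.κ' * (p.σ₂ ^ 2 * p.H ^ 2 * p.ζ ^ 2 / (p.μ ^ 4 * p.B ^ 2 * R ^ 4)),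
    p.κ' * (p.τ ^ 2 * p.σ₂ ^ 4 / (p.μ ^ 6 * K * R ^ 5 * p.B ^ 2)),
    p.κ' * (p.σ₄ ^ 4 * Real.log K / (p.μ ^ 4 * K * p.B ^ 2 * R ^ 4)) ]

/-- The sum of the terms of the rate other than the exponentially decaying one. -/
def Params.rate (p : Params) : ℝ := p.rateTerms.sum

/-- The accuracy `ε` used to tune the step size: the largest of the terms of the rate and of the
target accuracy `εt`. -/
def Params.accuracy (p : Params) (εt : ℝ) : ℝ := p.rateTerms.foldr max εt

/-- The logarithmic factor `max {1, ln (B² / ε)}` hidden by the soft-O notation. -/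
def Params.logFactor (p : Params) (εt : ℝ) : ℝ :=
  max 1 (Real.log (p.B ^ 2 / p.accuracy εt))

/-- The tuned step size `min {1 / (2H), ln (B² / ε) / (μ K R)}`. -/
def Params.tunedStep (p : Params) (εt : ℝ) : ℝ :=
  min (1 / (2 * p.H)) (1 / (p.μ * p.K * p.R) * Real.log (p.B ^ 2 / p.accuracy εt))

/-- A problem instance: the objective of each machine, its data distribution, and its stochastic
gradient oracle, which on a query `x` samples a datum `z` and returns `g m x z`. -/
structure Problem (d M : ℕ) (Z : Type*) [MeasurableSpace Z] where
  /-- objectives -/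
  F : Fin M → Space d → ℝ
  /-- data distributions -/
  D : Fin M → Measure Z
  /-- stochastic gradients -/
  g : Fin M → Space d → Z → Space d

/-- The set of minimizers of a function. -/
def optima {d : ℕ} (f : Space d → ℝ) : Set (Space d) := {x | IsMinOn f Set.univ x}

/-- The Hessian, as the derivative of the gradient; its norm is the operator norm. -/
def hessian {d : ℕ} (f : Space d → ℝ) (x : Space d) : Space d →L[ℝ] Space d :=
  fderiv ℝ (gradient f) x

namespace Problem

variable {d M : ℕ} {Z : Type*} [MeasurableSpace Z]

/-- The average objective `F = (1/M) ∑ₘ Fₘ`. -/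
def avg (P : Problem d M Z) (x : Space d) : ℝ := (1 / (M : ℝ)) * ∑ m, P.F m x

/-- The oracle draws from probability distributions, is measurable, and is unbiased. -/
def UnbiasedOracle (P : Problem d M Z) : Prop :=
  ∀ m, IsProbabilityMeasure (P.D m) ∧ Measurable (Function.uncurry (P.g m)) ∧
    ∀ x, Integrable (P.g m x) (P.D m) ∧ ∫ z, P.g m x z ∂(P.D m) = gradient (P.F m) x

/-- `μ`-strong convexity of every machine's objective. -/
def StronglyConvex (P : Problem d M Z) (μ : ℝ) : Prop :=
  ∀ m, Differentiable ℝ (P.F m) ∧ ∀ x y : Space d,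
    P.F m x + inner ℝ (gradient (P.F m) x) (y - x) + μ / 2 * ‖x - y‖ ^ 2 ≤ P.F m y

/-- Second-order smoothness. -/
def SmoothSecond (P : Problem d M Z) (H : ℝ) : Prop :=
  ∀ m, Differentiable ℝ (P.F m) ∧ ∀ x y : Space d,
    ‖gradient (P.F m) x - gradient (P.F m) y‖ ≤ H * ‖x - y‖

/-- Third-order smoothness. -/
def SmoothThird (P : Problem d M Z) (Q : ℝ) : Prop :=
  ∀ m, ContDiff ℝ 2 (P.F m) ∧ ∀ x y : Space d,
    ‖hessian (P.F m) x - hessian (P.F m) y‖ ≤ Q * ‖x - y‖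

/-- The gradient noise of machine `m` has `q`-th moment at most `s m ^ q` at every point, and the
average over the machines of `s m ^ q` is at most `σ ^ q`. -/
def NoiseMoment (P : Problem d M Z) (q : ℕ) (σ : ℝ) : Prop :=
  ∃ s : Fin M → ℝ, (∀ m, 0 ≤ s m) ∧ (1 / (M : ℝ)) * ∑ m, s m ^ q ≤ σ ^ q ∧
    ∀ m x, Integrable (fun z => ‖P.g m x z - gradient (P.F m) x‖ ^ q) (P.D m) ∧
      ∫ z, ‖P.g m x z - gradient (P.F m) x‖ ^ q ∂(P.D m) ≤ s m ^ q

/-- The distance between the sets of optima of machines `m` and `n`. -/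
def zetaPair (P : Problem d M Z) (m n : Fin M) : ℝ :=
  sInf ((fun xy : Space d × Space d => ‖xy.1 - xy.2‖) '' (optima (P.F m) ×ˢ optima (P.F n)))

/-- Discrepancy between the machines' optima, as a fourth-power mean. -/
def OptimaDiscrepancy (P : Problem d M Z) (ζ : ℝ) : Prop :=
  (1 / (M : ℝ) ^ 2) * ∑ m, ∑ n, P.zetaPair m n ^ 4 ≤ ζ ^ 4

/-- Discrepancy between the machines' optima and the optimum `xs` of the average objective, as a
fourth-power mean. -/
def AvgOptimaDiscrepancy (P : Problem d M Z) (xs : Space d) (φ : ℝ) : Prop :=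
  (1 / (M : ℝ)) * ∑ m, Metric.infDist xs (optima (P.F m)) ^ 4 ≤ φ ^ 4

/-- Second-order heterogeneity. -/
def HessianHeterogeneity (P : Problem d M Z) (τ : ℝ) : Prop :=
  ∀ m n x, ‖hessian (P.F m) x - hessian (P.F n) x‖ ≤ τ

/-- The vector of local models of vanilla Local SGD after `t` steps with step size `η`, started at
`0`, when machine `m` draws the datum `z t m` at time `t`. The models are averaged whenever the
number of completed steps is a multiple of `K`. -/
def localIterate (P : Problem d M Z) (K : ℕ) (η : ℝ) (z : ℕ → Fin M → Z) :
    ℕ → Fin M → Space d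
  | 0 => fun _ => 0
  | t + 1 => fun m =>
      let x := localIterate P K η z t
      if (t + 1) % K = 0 then
        (1 / (M : ℝ)) • ∑ n, (x n - η • P.g n (x n) (z t n))
      else
        x m - η • P.g m (x m) (z t m)

/-- The average `x_t` of the local models at time `t`. -/
def iterate (P : Problem d M Z) (K : ℕ) (η : ℝ) (z : ℕ → Fin M → Z) (t : ℕ) : Space d :=
  (1 / (M : ℝ)) • ∑ m, P.localIterate K η z t m

end Problem

/-- The instance `P`, with `xs` an optimum of its average objective, belongs to the problem class
with parameters `p`. -/
structure InClass {d : ℕ} {Z : Type*} [MeasurableSpace Z] (p : Params) (P : Problem d p.M Z)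
    (xs : Space d) : Prop where
  oracle : P.UnbiasedOracle
  strongly_convex : P.StronglyConvex p.μ
  smooth_second : P.SmoothSecond p.H
  smooth_third : P.SmoothThird p.Q
  second_moment : P.NoiseMoment 2 p.σ₂
  fourth_moment : P.NoiseMoment 4 p.σ₄
  optimum : xs ∈ optima P.avg
  bounded_optimum : ‖xs‖ ≤ p.B
  optima_discrepancy : P.OptimaDiscrepancy p.ζ
  avg_optima_discrepancy : P.AvgOptimaDiscrepancy xs p.φ
  hessian_heterogeneity : P.HessianHeterogeneity p.τ

/-- `z t m` (time `t`, machine `m`) are independent random data with laws `D m`. -/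
structure IsSampling {M : ℕ} {Z Ω : Type*} [MeasurableSpace Z] [MeasurableSpace Ω]
    (Pr : Measure Ω) (D : Fin M → Measure Z) (z : ℕ → Fin M → Ω → Z) : Prop where
  measurable : ∀ t m, Measurable (z t m)
  law : ∀ t m, Measure.map (z t m) Pr = D m
  indep : iIndepFun (fun tm : ℕ × Fin M => z tm.1 tm.2) Pr

/-- The random vector `x_{KR} - xs` produced by Local SGD with step size `η`. -/
def finalError {d : ℕ} {Z Ω : Type*} [MeasurableSpace Z] (p : Params) (P : Problem d p.M Z)
    (xs : Space d) (η : ℝ) (z : ℕ → Fin p.M → Ω → Z) (ω : Ω) : Space d :=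
  P.iterate p.K η (fun t m => z t m ω) (p.K * p.R) - xs

/-- `E ‖x_{KR} - xs‖² + E ‖x_{KR} - xs‖⁴ / B²`. -/
def totalError {d : ℕ} {Z Ω : Type*} [MeasurableSpace Z] [MeasurableSpace Ω] (p : Params)
    (P : Problem d p.M Z) (xs : Space d) (η : ℝ) (Pr : Measure Ω)
    (z : ℕ → Fin p.M → Ω → Z) : ℝ :=
  (∫ ω, ‖finalError p P xs η z ω‖ ^ 2 ∂Pr) +
    1 / p.B ^ 2 * (∫ ω, ‖finalError p P xs η z ω‖ ^ 4 ∂Pr)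

end LocalSGD

end

/-!
Let `Λ = max {1, ln (B² / ε)}`. The averaged model is measured by `‖x_t - x⋆‖² + ‖x_t - x⋆‖⁴ / B²`,
and the disagreement of the machines by the averages of the second and fourth powers of their mutual
distances, with weights of order `Λ τ² / μ²` and `Λ³ κ' / B²`.

The noise has mean zero given the past, so a step of the averaged model contracts its error by
`(1 - ημ)²`, up to the variance of the averaged noise and a bias, the mean of the local gradients
minus the gradient of `F` at the averaged model. The average Hessian does not contribute to this
bias, which is therefore at most `τ` times the mean distance plus `Q` times the mean squared
distance of the local models to their average; in the fourth moment the Lipschitz bound `H` is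
enough. Young's inequality with weight `ημ / Λ` absorbs the bias, and the factors
`1 + O(ημ / Λ)` it costs multiply to a constant over a horizon `ημKR ≤ Λ`.

The disagreement vanishes at each averaging. In between it is driven by the noise and by the
heterogeneity of the gradients, of order `H ζ⋆ + τ φ⋆ + τ ‖x_t - x⋆‖` up to `τ` times the
disagreement itself; since `R ≥ (τ √κ' / μ) Λ²`, the error of the averaged model feeds back into it
over a whole round with a coefficient of order `1 / Λ` only. An explicit supersolution of the two
coupled recursions and the choice of `η` give the bounds. If `B² ≤ e ε`, the initial error is
already of the size of the target, and every sufficiently small step preserves that size.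
-/

noncomputable section

namespace LocalSGD

open scoped BigOperators Topology

section Calculus

variable {E : Type*} [NormedAddCommGroup E] [InnerProductSpace ℝ E] [CompleteSpace E]
  {f g : E → ℝ} {H μ η : ℝ}

/-- Strong convexity of a single differentiable function, in the first-order form in which
`Problem.StronglyConvex` imposes it on every machine. -/
def IsStronglyConvex (μ : ℝ) (f : E → ℝ) : Prop :=
  Differentiable ℝ f ∧ ∀ x y : E,
    f x + inner ℝ (gradient f x) (y - x) + μ / 2 * ‖x - y‖ ^ 2 ≤ f y

/-- Second-order smoothness of a single function, in the form in which `Problem.SmoothSecond`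
imposes it on every machine. -/
def IsSmooth (H : ℝ) (f : E → ℝ) : Prop :=
  Differentiable ℝ f ∧ ∀ x y : E, ‖gradient f x - gradient f y‖ ≤ H * ‖x - y‖

theorem hasDerivAt_comp_add_smul (hf : Differentiable ℝ f) (x v : E) (t : ℝ) :
    HasDerivAt (fun t : ℝ => f (x + t • v)) (inner ℝ (gradient f (x + t • v)) v) t := by
  have hline : HasDerivAt (fun t : ℝ => x + t • v) v t := by
    simpa using ((hasDerivAt_id t).smul_const v).const_add x
  rw [inner_gradient_left]
  exact (hf (x + t • v)).hasFDerivAt.comp_hasDerivAt t hline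

theorem IsSmooth.le_add_inner_add_sq (hf : IsSmooth H f) (x v : E) :
    f (x + v) ≤ f x + inner ℝ (gradient f x) v + H / 2 * ‖v‖ ^ 2 := by
  set gap : ℝ → ℝ :=
    fun t => f (x + t • v) - t * inner ℝ (gradient f x) v - t ^ 2 * (H / 2 * ‖v‖ ^ 2) with hgap
  have hderiv (t : ℝ) : HasDerivAt gap (inner ℝ (gradient f (x + t • v)) v
      - inner ℝ (gradient f x) v - 2 * t * (H / 2 * ‖v‖ ^ 2)) t := by
    simpa [hgap, -inner_gradient_left] using ((hasDerivAt_comp_add_smul hf.1 x v t).fun_sub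
      ((hasDerivAt_id' t).mul_const (inner ℝ (gradient f x) v))).fun_sub
      ((hasDerivAt_pow 2 t).mul_const (H / 2 * ‖v‖ ^ 2))
  have hanti : AntitoneOn gap (Set.Icc 0 1) := by
    refine antitoneOn_of_deriv_nonpos (convex_Icc 0 1)
      (fun t _ => (hderiv t).continuousAt.continuousWithinAt)
      (fun t _ => (hderiv t).differentiableAt.differentiableWithinAt) fun t ht => ?_
    rw [interior_Icc] at ht
    have hlip : ‖gradient f (x + t • v) - gradient f x‖ ≤ H * (t * ‖v‖) := by
      simpa [norm_smul, abs_of_pos ht.1] using hf.2 (x + t • v) x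
    have hcs := real_inner_le_norm (gradient f (x + t • v) - gradient f x) v
    rw [(hderiv t).deriv, ← inner_sub_left]
    nlinarith [mul_le_mul_of_nonneg_right hlip (norm_nonneg v)]
  have hends : gap 1 ≤ gap 0 :=
    hanti (Set.left_mem_Icc.2 zero_le_one) (Set.right_mem_Icc.2 zero_le_one) zero_le_one
  simp only [hgap, one_smul, zero_smul, add_zero, one_mul, one_pow, zero_mul, sub_zero, ne_eq,
    OfNat.ofNat_ne_zero, not_false_eq_true, zero_pow] at hends
  linarith

theorem IsStronglyConvex.norm_sq_le_inner (hsc : IsStronglyConvex μ f) (hf : IsSmooth H f)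
    (hH : 0 < H) (hμ : 0 ≤ μ) (x y : E) :
    ‖gradient f y - gradient f x - μ • (y - x)‖ ^ 2 ≤
      H * inner ℝ (gradient f y - gradient f x - μ • (y - x)) (y - x) := by
  set Δ := y - x with hΔ
  set b := gradient f y - gradient f x - μ • Δ with hb
  obtain ⟨v, hbv⟩ : ∃ v, b = H • v := ⟨(1 / H) • b, by rw [smul_smul, mul_one_div_cancel hH.ne',
    one_smul]⟩
  -- Both `f (y - v)` and `f (x + v)` are bounded below by convexity from the far end of the
  -- segment and above by smoothness from the near end; the four inequalities are then added.
  have lower_y := hsc.2 x (y - v)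
  have upper_y := hf.le_add_inner_add_sq y (-v)
  have lower_x := hsc.2 y (x + v)
  have upper_x := hf.le_add_inner_add_sq x v
  rw [show y - v - x = Δ - v by rw [hΔ]; abel, show x - (y - v) = -(Δ - v) by rw [hΔ]; abel,
    norm_neg] at lower_y
  rw [show x + v - y = -(Δ - v) by rw [hΔ]; abel, show y - (x + v) = Δ - v by rw [hΔ]; abel]
    at lower_x
  rw [← sub_eq_add_neg, norm_neg] at upper_y
  rw [show gradient f y = b + gradient f x + μ • Δ by rw [hb]; abel] at upper_y lower_x
  rw [norm_sub_sq_real] at lower_y lower_x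
  have hinner : inner ℝ b v = H * ‖v‖ ^ 2 := by
    rw [hbv, real_inner_smul_left, real_inner_self_eq_norm_sq]
  have hnorm : ‖b‖ ^ 2 = H ^ 2 * ‖v‖ ^ 2 := by
    rw [hbv, norm_smul, Real.norm_of_nonneg hH.le]; ring
  simp only [inner_add_left, inner_sub_right, inner_neg_right, real_inner_smul_left,
    real_inner_self_eq_norm_sq, hinner] at lower_y upper_y lower_x upper_x
  have hsum : H * ‖v‖ ^ 2 ≤ inner ℝ b Δ := by nlinarith [mul_nonneg hμ (sq_nonneg ‖v‖)]
  rw [hnorm]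
  nlinarith [mul_le_mul_of_nonneg_left hsum hH.le]

theorem IsStronglyConvex.norm_gradientStep_sub_le (hsc : IsStronglyConvex μ f)
    (hf : IsSmooth H f) (hH : 0 < H) (hμ : 0 ≤ μ) (hμH : μ ≤ H) (hη : 0 ≤ η)
    (hηH : η ≤ 1 / (2 * H)) (x y : E) :
    ‖(x - η • gradient f x) - (y - η • gradient f y)‖ ≤ (1 - η * μ) * ‖x - y‖ := by
  have hηH' : η * H ≤ 1 / 2 := by
    rw [le_div_iff₀ (by positivity)] at hηH
    linarith
  have hημ : η * μ ≤ 1 / 2 := (mul_le_mul_of_nonneg_left hμH hη).trans hηH'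
  have hρ : 0 ≤ 1 - η * μ := by linarith
  have hcoc := hsc.norm_sq_le_inner hf hH hμ y x
  set b := gradient f x - gradient f y - μ • (x - y) with hb
  have hmono : 0 ≤ inner ℝ b (x - y) :=
    nonneg_of_mul_nonneg_right ((sq_nonneg ‖b‖).trans hcoc) hH
  have hsq : η ^ 2 * ‖b‖ ^ 2 ≤ η * (1 / 2) * inner ℝ b (x - y) := by
    calc η ^ 2 * ‖b‖ ^ 2 ≤ η ^ 2 * (H * inner ℝ b (x - y)) := by gcongr
      _ = η * (η * H) * inner ℝ b (x - y) := by ring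
      _ ≤ η * (1 / 2) * inner ℝ b (x - y) := by gcongr
  have hsplit : (x - η • gradient f x) - (y - η • gradient f y) =
      (1 - η * μ) • (x - y) - η • b := by
    rw [hb]; module
  refine (abs_le_of_sq_le_sq' ?_ (by positivity)).2
  rw [hsplit, norm_sub_sq_real, norm_smul, norm_smul, real_inner_smul_left, real_inner_smul_right,
    real_inner_comm, Real.norm_of_nonneg hρ, Real.norm_of_nonneg hη]
  nlinarith [mul_nonneg (mul_nonneg hη hmono) (sub_nonneg.2 hημ), mul_nonneg hη hmono]

theorem IsStronglyConvex.le_of_isSmooth [Nontrivial E] (hsc : IsStronglyConvex μ f)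
    (hf : IsSmooth H f) : μ ≤ H := by
  obtain ⟨v, hv⟩ := exists_ne (0 : E)
  have lower := hsc.2 0 v
  have upper := hf.le_add_inner_add_sq 0 v
  simp only [sub_zero, zero_sub, norm_neg, zero_add] at lower upper
  have : 0 < ‖v‖ ^ 2 := by positivity
  nlinarith

theorem gradient_eq_zero_of_isMinOn_univ {x : E} (hx : IsMinOn f Set.univ x) :
    gradient f x = 0 := by
  simp [gradient, (hx.isLocalMin Filter.univ_mem).fderiv_eq_zero]

theorem IsStronglyConvex.exists_isMinOn [FiniteDimensional ℝ E] (hμ : 0 < μ)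
    (hsc : IsStronglyConvex μ f) : ∃ x, IsMinOn f Set.univ x := by
  have : ProperSpace E := FiniteDimensional.proper ℝ E
  have hcoercive : ∀ᶠ y in Filter.cocompact E, f 0 ≤ f y := by
    filter_upwards [tendsto_norm_cocompact_atTop.eventually_ge_atTop (2 * ‖gradient f 0‖ / μ)]
      with y hy
    have hconv := hsc.2 0 y
    simp only [sub_zero, zero_sub, norm_neg] at hconv
    have hcs := neg_le_of_abs_le (abs_real_inner_le_norm (gradient f 0) y)
    rw [div_le_iff₀ hμ] at hy
    nlinarith [mul_le_mul_of_nonneg_right hy (norm_nonneg y)]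
  obtain ⟨x, hx⟩ := hsc.1.continuous.exists_forall_le' 0 hcoercive
  exact ⟨x, fun y _ => hx y⟩

theorem IsStronglyConvex.eq_of_isMinOn (hμ : 0 < μ) (hsc : IsStronglyConvex μ f) {x y : E}
    (hx : IsMinOn f Set.univ x) (hy : IsMinOn f Set.univ y) : x = y := by
  have hconv := hsc.2 x y
  rw [gradient_eq_zero_of_isMinOn_univ hx, inner_zero_left] at hconv
  have hyx : f y ≤ f x := hy (Set.mem_univ x)
  have hsq : ‖x - y‖ ^ 2 ≤ 0 := by nlinarith
  simpa [sub_eq_zero] using hsq.antisymm (sq_nonneg _)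

theorem differentiable_gradient (hf : ContDiff ℝ 2 f) : Differentiable ℝ (gradient f) :=
  have hf' : ContDiff ℝ 1 (fderiv ℝ f) := hf.fderiv_right (by norm_num)
  (InnerProductSpace.toDual ℝ E).symm.differentiable.comp (hf'.differentiable (by norm_num))

theorem norm_gradient_sub_gradient_sub_le {τ : ℝ} (hf : ContDiff ℝ 2 f) (hg : ContDiff ℝ 2 g)
    (hτ : ∀ x, ‖fderiv ℝ (gradient f) x - fderiv ℝ (gradient g) x‖ ≤ τ) (x y : E) :
    ‖(gradient f x - gradient g x) - (gradient f y - gradient g y)‖ ≤ τ * ‖x - y‖ :=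
  convex_univ.norm_image_sub_le_of_norm_hasFDerivWithin_le
    (f := fun x => gradient f x - gradient g x)
    (fun x _ => ((differentiable_gradient hf x).hasFDerivAt.sub
      (differentiable_gradient hg x).hasFDerivAt).hasFDerivWithinAt)
    (fun x _ => hτ x) (Set.mem_univ y) (Set.mem_univ x)

theorem norm_gradient_sub_gradient_sub_apply_le {τ Q : ℝ} (hf : ContDiff ℝ 2 f) (hQ : 0 ≤ Q)
    (hlip : ∀ x y, ‖fderiv ℝ (gradient f) x - fderiv ℝ (gradient f) y‖ ≤ Q * ‖x - y‖) {y : E}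
    {A : E →L[ℝ] E} (hA : ‖fderiv ℝ (gradient f) y - A‖ ≤ τ) (x : E) :
    ‖gradient f x - gradient f y - A (x - y)‖ ≤ (τ + Q * ‖x - y‖) * ‖x - y‖ := by
  refine (convex_closedBall y ‖x - y‖).norm_image_sub_le_of_norm_hasFDerivWithin_le'
    (fun z _ => (differentiable_gradient hf z).hasFDerivAt.hasFDerivWithinAt)
    (fun z hz => ?_) (by simp) (by simp [dist_eq_norm])
  rw [Metric.mem_closedBall, dist_eq_norm] at hz
  calc ‖fderiv ℝ (gradient f) z - A‖
      = ‖(fderiv ℝ (gradient f) y - A) + (fderiv ℝ (gradient f) z - fderiv ℝ (gradient f) y)‖ := by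
        congr 1; abel
    _ ≤ τ + Q * ‖z - y‖ := norm_add_le_of_le hA (hlip z y)
    _ ≤ τ + Q * ‖x - y‖ := by gcongr

end Calculus

section Moments

variable {E : Type*} [NormedAddCommGroup E] [InnerProductSpace ℝ E]

theorem norm_add_pow_four_le (a x : E) :
    ‖a + x‖ ^ 4 ≤ ‖a‖ ^ 4 + 4 * inner ℝ (‖a‖ ^ 2 • a) x + 8 * (‖a‖ ^ 2 * ‖x‖ ^ 2) +
      3 * ‖x‖ ^ 4 := by
  have hexpand : ‖a + x‖ ^ 4 = (‖a‖ ^ 2 + 2 * inner ℝ a x + ‖x‖ ^ 2) ^ 2 := by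
    rw [← norm_add_sq_real]; ring
  have hcs : inner ℝ a x ≤ ‖a‖ * ‖x‖ := real_inner_le_norm a x
  have hcs_sq : inner ℝ a x ^ 2 ≤ ‖a‖ ^ 2 * ‖x‖ ^ 2 := by
    rw [← mul_pow]
    exact sq_le_sq' (neg_le_of_abs_le (abs_real_inner_le_norm a x)) hcs
  have hcubic : inner ℝ a x * ‖x‖ ^ 2 ≤ ‖a‖ * ‖x‖ * ‖x‖ ^ 2 := by gcongr
  rw [hexpand, real_inner_smul_left]
  nlinarith [mul_nonneg (sq_nonneg ‖x‖) (sq_nonneg (‖a‖ - ‖x‖))]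

variable [MeasurableSpace E] [BorelSpace E] {W : Type*} [MeasurableSpace W]
  {ν : Measure W} {X Y : W → E}

theorem integrable_inner_of_indep (h : IndepFun Y X ν) (hY : Integrable Y ν)
    (hX : Integrable X ν) : Integrable (fun w => inner ℝ (Y w) (X w)) ν :=
  h.integrable_bilin hY hX (innerSL ℝ)

variable [CompleteSpace E]

theorem integral_inner_eq_zero_of_indep (h : IndepFun Y X ν) (hY : Integrable Y ν)
    (hX : Integrable X ν) (hX0 : ∫ w, X w ∂ν = 0) : ∫ w, inner ℝ (Y w) (X w) ∂ν = 0 :=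
  (h.integral_bilin hY hX (innerSL ℝ)).trans (by rw [hX0, map_zero])

variable [IsFiniteMeasure ν]

theorem integral_norm_add_sq_of_indep (h : IndepFun Y X ν) (hY : MemLp Y 2 ν) (hX : MemLp X 2 ν)
    (hX0 : ∫ w, X w ∂ν = 0) :
    ∫ w, ‖Y w + X w‖ ^ 2 ∂ν = ∫ w, ‖Y w‖ ^ 2 ∂ν + ∫ w, ‖X w‖ ^ 2 ∂ν := by
  have hY1 := hY.integrable one_le_two
  have hX1 := hX.integrable one_le_two
  have hY2 := hY.integrable_norm_pow two_ne_zero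
  have hX2 := hX.integrable_norm_pow two_ne_zero
  have hcross := (integrable_inner_of_indep h hY1 hX1).const_mul 2
  simp_rw [norm_add_sq_real]
  rw [integral_add (hY2.fun_add hcross) hX2, integral_add hY2 hcross, integral_const_mul,
    integral_inner_eq_zero_of_indep h hY1 hX1 hX0]
  ring

theorem integral_norm_add_pow_four_le_of_indep (h : IndepFun Y X ν) (hY : MemLp Y 4 ν)
    (hX : MemLp X 4 ν) (hX0 : ∫ w, X w ∂ν = 0) :
    ∫ w, ‖Y w + X w‖ ^ 4 ∂ν ≤ ∫ w, ‖Y w‖ ^ 4 ∂ν +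
      8 * ((∫ w, ‖Y w‖ ^ 2 ∂ν) * ∫ w, ‖X w‖ ^ 2 ∂ν) + 3 * ∫ w, ‖X w‖ ^ 4 ∂ν := by
  have hX1 := hX.integrable (by norm_num)
  have hY2 := (hY.mono_exponent (p := 2) (by norm_num)).integrable_norm_pow two_ne_zero
  have hX2 := (hX.mono_exponent (p := 2) (by norm_num)).integrable_norm_pow two_ne_zero
  have hY4 := hY.integrable_norm_pow (p := 4) four_ne_zero
  have hX4 := hX.integrable_norm_pow (p := 4) four_ne_zero
  have hcube : Integrable (fun w => ‖Y w‖ ^ 2 • Y w) ν := by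
    have hY3 := (hY.mono_exponent (p := 3) (by norm_num)).integrable_norm_pow three_ne_zero
    refine (integrable_norm_iff ((hY.1.norm.pow 2).smul hY.1)).1
      (hY3.congr (.of_forall fun w => ?_))
    simp [norm_smul, pow_succ]
  have hindep_cube : IndepFun (fun w => ‖Y w‖ ^ 2 • Y w) X ν :=
    h.comp (φ := fun y : E => ‖y‖ ^ 2 • y) (ψ := id)
      (Continuous.measurable (by fun_prop)) measurable_id
  have hindep_sq : IndepFun (fun w => ‖Y w‖ ^ 2) (fun w => ‖X w‖ ^ 2) ν :=
    h.comp (φ := fun y : E => ‖y‖ ^ 2) (ψ := fun y : E => ‖y‖ ^ 2) (by fun_prop) (by fun_prop)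
  have hcross := (integrable_inner_of_indep hindep_cube hcube hX1).const_mul 4
  have hprod := (hindep_sq.integrable_mul hY2 hX2).const_mul 8
  have hprod_eq := hindep_sq.integral_mul_eq_mul_integral hY2.1 hX2.1
  simp only [Pi.mul_def] at hprod hprod_eq
  calc ∫ w, ‖Y w + X w‖ ^ 4 ∂ν
      ≤ ∫ w, (‖Y w‖ ^ 4 + 4 * inner ℝ (‖Y w‖ ^ 2 • Y w) (X w) + 8 * (‖Y w‖ ^ 2 * ‖X w‖ ^ 2) +
          3 * ‖X w‖ ^ 4) ∂ν :=
        integral_mono ((hY.add hX).integrable_norm_pow (p := 4) four_ne_zero)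
          (((hY4.fun_add hcross).fun_add hprod).add (hX4.const_mul 3))
          fun w => norm_add_pow_four_le _ _
    _ = _ := by
        rw [integral_add ((hY4.fun_add hcross).fun_add hprod) (hX4.const_mul 3),
          integral_add (hY4.fun_add hcross) hprod, integral_add hY4 hcross, integral_const_mul,
          integral_const_mul, integral_const_mul, hprod_eq,
          integral_inner_eq_zero_of_indep hindep_cube hcube hX1 hX0]
        ring

end Moments

section IndependentSums

theorem indepFun_add_sum_of_notMem {E ι W : Type*} [AddCommMonoid E] [MeasurableSpace E]
    [MeasurableAdd₂ E] [MeasurableSpace W] {ν : Measure W} {X : ι → W → E} (hind : iIndepFun X ν)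
    (hm : ∀ i, Measurable (X i)) (u : E) {I : Finset ι} {j : ι} (hj : j ∉ I) :
    IndepFun (fun w => u + ∑ i ∈ I, X i w) (X j) ν := by
  simpa [Function.comp_def] using (hind.indepFun_finsetSum_of_notMem hm hj).comp
    (φ := fun y => u + y) (ψ := id) (by fun_prop) measurable_id

variable {E : Type*} [NormedAddCommGroup E] [InnerProductSpace ℝ E] [CompleteSpace E]
  [MeasurableSpace E] [BorelSpace E] [SecondCountableTopology E] {ι W : Type*} [MeasurableSpace W]
  {ν : Measure W} [IsProbabilityMeasure ν] {X : ι → W → E}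

theorem integral_norm_add_sum_sq (hind : iIndepFun X ν) (hm : ∀ i, Measurable (X i))
    (hX : ∀ i, MemLp (X i) 2 ν) (hX0 : ∀ i, ∫ w, X i w ∂ν = 0) (u : E) (I : Finset ι) :
    ∫ w, ‖u + ∑ i ∈ I, X i w‖ ^ 2 ∂ν = ‖u‖ ^ 2 + ∑ i ∈ I, ∫ w, ‖X i w‖ ^ 2 ∂ν := by
  classical
  induction I using Finset.induction_on with
  | empty => simp
  | insert j I hj ih =>
    simp_rw [Finset.sum_insert hj, add_comm (X j _), ← add_assoc]
    rw [integral_norm_add_sq_of_indep (indepFun_add_sum_of_notMem hind hm u hj)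
      ((memLp_const u).add (memLp_finsetSum I fun i _ => hX i)) (hX j) (hX0 j), ih]
    ring

theorem integral_norm_add_sum_pow_four_le (hind : iIndepFun X ν) (hm : ∀ i, Measurable (X i))
    (hX : ∀ i, MemLp (X i) 4 ν) (hX0 : ∀ i, ∫ w, X i w ∂ν = 0) (u : E) (I : Finset ι) :
    ∫ w, ‖u + ∑ i ∈ I, X i w‖ ^ 4 ∂ν ≤ ‖u‖ ^ 4 + 8 * ‖u‖ ^ 2 * (∑ i ∈ I, ∫ w, ‖X i w‖ ^ 2 ∂ν) +
      8 * (∑ i ∈ I, ∫ w, ‖X i w‖ ^ 2 ∂ν) ^ 2 + 3 * ∑ i ∈ I, ∫ w, ‖X i w‖ ^ 4 ∂ν := by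
  classical
  induction I using Finset.induction_on with
  | empty => simp
  | insert j I hj ih =>
    have hstep := integral_norm_add_pow_four_le_of_indep (indepFun_add_sum_of_notMem hind hm u hj)
      ((memLp_const u).add (memLp_finsetSum I fun i _ => hX i)) (hX j) (hX0 j)
    rw [integral_norm_add_sum_sq hind hm (fun i => (hX i).mono_exponent (by norm_num)) hX0] at hstep
    simp_rw [Finset.sum_insert hj, add_comm (X j _), ← add_assoc]
    have hvar (i : ι) : 0 ≤ ∫ w, ‖X i w‖ ^ 2 ∂ν := integral_nonneg fun w => by positivity
    nlinarith [hvar j, Finset.sum_nonneg fun i (_ : i ∈ I) => hvar i]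

end IndependentSums

section MeanBounds

variable {W : Type*} [MeasurableSpace W] {ν : Measure W} {f g : W → ℝ} {a b c : ℝ}

/-- `f` is `ν`-integrable with integral at most `c`. Integrability is part of the notion because
the integral of a non-integrable function is `0`. -/
def HasMeanLE (ν : Measure W) (f : W → ℝ) (c : ℝ) : Prop :=
  Integrable f ν ∧ ∫ w, f w ∂ν ≤ c

theorem HasMeanLE.trans_le (hf : HasMeanLE ν f a) (hab : a ≤ b) : HasMeanLE ν f b :=
  ⟨hf.1, hf.2.trans hab⟩

theorem hasMeanLE_integral (hf : Integrable f ν) : HasMeanLE ν f (∫ w, f w ∂ν) := ⟨hf, le_rfl⟩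

theorem hasMeanLE_const [IsProbabilityMeasure ν] (c : ℝ) : HasMeanLE ν (fun _ => c) c :=
  ⟨integrable_const c, by simp⟩

theorem HasMeanLE.add (hf : HasMeanLE ν f a) (hg : HasMeanLE ν g b) :
    HasMeanLE ν (fun w => f w + g w) (a + b) :=
  ⟨hf.1.add hg.1, (integral_add hf.1 hg.1).trans_le (add_le_add hf.2 hg.2)⟩

theorem HasMeanLE.const_mul (hf : HasMeanLE ν f a) (hc : 0 ≤ c) :
    HasMeanLE ν (fun w => c * f w) (c * a) :=
  ⟨hf.1.const_mul c, (integral_const_mul c f).trans_le (mul_le_mul_of_nonneg_left hf.2 hc)⟩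

theorem HasMeanLE.div_const (hf : HasMeanLE ν f a) (hc : 0 ≤ c) :
    HasMeanLE ν (fun w => f w / c) (a / c) := by
  simpa only [div_eq_inv_mul] using hf.const_mul (inv_nonneg.2 hc)

theorem HasMeanLE.mono (hg : HasMeanLE ν g c) (hf : AEStronglyMeasurable f ν) (hf0 : 0 ≤ f)
    (hfg : f ≤ g) : HasMeanLE ν f c := by
  have hfi : Integrable f ν :=
    hg.1.mono' hf (.of_forall fun w => by rw [Real.norm_of_nonneg (hf0 w)]; exact hfg w)
  exact ⟨hfi, (integral_mono hfi hg.1 hfg).trans hg.2⟩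

theorem sq_integral_le [IsProbabilityMeasure ν] (hf : MemLp f 2 ν) :
    (∫ w, f w ∂ν) ^ 2 ≤ ∫ w, f w ^ 2 ∂ν := by
  have hvar := variance_nonneg f ν
  rw [variance_eq_sub hf] at hvar
  simpa using hvar

/-- Conditioning on `X` by Fubini's theorem. -/
theorem hasMeanLE_comp_of_indep {Ω S : Type*} [MeasurableSpace Ω] [MeasurableSpace S]
    {Pr : Measure Ω} [IsProbabilityMeasure Pr] [SFinite ν] {X : Ω → S} {Y : Ω → W}
    (hX : Measurable X) (hY : Measurable Y) (hlaw : Measure.map Y Pr = ν) (hind : IndepFun X Y Pr)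
    {φ : S → W → ℝ} (hφ : Measurable (Function.uncurry φ)) (hφ0 : ∀ s w, 0 ≤ φ s w)
    {ψ : S → ℝ} (hψ : Measurable ψ) (hφψ : ∀ s, HasMeanLE ν (φ s) (ψ s))
    (hψX : HasMeanLE Pr (fun ω => ψ (X ω)) c) :
    HasMeanLE Pr (fun ω => φ (X ω) (Y ω)) c := by
  have hXY := (indepFun_iff_map_prod_eq_prod_map_map hX.aemeasurable hY.aemeasurable).1 hind
  rw [hlaw] at hXY
  have hψ_int : Integrable ψ (Measure.map X Pr) :=
    (integrable_map_measure hψ.aestronglyMeasurable hX.aemeasurable).2 hψX.1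
  have hinner : Integrable (fun s => ∫ w, φ s w ∂ν) (Measure.map X Pr) := by
    refine hψ_int.mono' hφ.stronglyMeasurable.integral_prod_right'.aestronglyMeasurable
      (.of_forall fun s => ?_)
    rw [Real.norm_of_nonneg (integral_nonneg (hφ0 s))]
    exact (hφψ s).2
  have hprod : Integrable (Function.uncurry φ) ((Measure.map X Pr).prod ν) :=
    (integrable_prod_iff hφ.aestronglyMeasurable).2 ⟨.of_forall fun s => (hφψ s).1, by
      simpa only [Function.uncurry_apply_pair, Real.norm_of_nonneg (hφ0 _ _)] using hinner⟩
  have hpair : AEMeasurable (fun ω => (X ω, Y ω)) Pr := (hX.prodMk hY).aemeasurable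
  refine ⟨(integrable_map_measure hφ.aestronglyMeasurable hpair).1 (hXY ▸ hprod), ?_⟩
  calc ∫ ω, φ (X ω) (Y ω) ∂Pr = ∫ p, Function.uncurry φ p ∂((Measure.map X Pr).prod ν) := by
        rw [← hXY, integral_map hpair hφ.aestronglyMeasurable]
        rfl
    _ = ∫ s, ∫ w, φ s w ∂ν ∂(Measure.map X Pr) := integral_prod _ hprod
    _ ≤ ∫ s, ψ s ∂(Measure.map X Pr) := integral_mono hinner hψ_int fun s => (hφψ s).2
    _ = ∫ ω, ψ (X ω) ∂Pr := integral_map hX.aemeasurable hψ.aestronglyMeasurable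
    _ ≤ c := hψX.2

end MeanBounds

section Averages

variable {ι : Type*} [Fintype ι]

theorem pow_expect_le [Nonempty ι] {f : ι → ℝ} (hf : ∀ i, 0 ≤ f i) (q : ℕ) :
    (𝔼 i, f i) ^ q ≤ 𝔼 i, f i ^ q := by
  have hjensen := Real.pow_arith_mean_le_arith_mean_pow Finset.univ
    (fun _ : ι => (Fintype.card ι : ℝ)⁻¹) f (fun _ _ => by positivity) (by simp)
    (fun i _ => hf i) q
  simpa only [← Finset.mul_sum, Fintype.expect_eq_sum_div_card, div_eq_inv_mul] using hjensen

theorem HasMeanLE.expect {W : Type*} [MeasurableSpace W] {ν : Measure W} {f : ι → W → ℝ}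
    {c : ι → ℝ} (hf : ∀ i, HasMeanLE ν (f i) (c i)) :
    HasMeanLE ν (fun w => 𝔼 i, f i w) (𝔼 i, c i) := by
  simp only [Fintype.expect_eq_sum_div_card]
  refine ⟨(integrable_finsetSum _ fun i _ => (hf i).1).div_const _, ?_⟩
  rw [integral_div, integral_finsetSum _ fun i _ => (hf i).1]
  gcongr with i
  exact (hf i).2

variable {E : Type*} [NormedAddCommGroup E]

/-- The average over all pairs of the `q`-th power of the distance between two members of a
family; the consensus error of a family of models is measured by `spread 2` and `spread 4`. -/
def spread (q : ℕ) (s : ι → E) : ℝ := 𝔼 i, 𝔼 j, ‖s i - s j‖ ^ q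

theorem spread_nonneg (q : ℕ) (s : ι → E) : 0 ≤ spread q s :=
  Finset.expect_nonneg fun _ _ => Finset.expect_nonneg fun _ _ => by positivity

variable [NormedSpace ℝ E]

/-- The average of a finite family of vectors. -/
def mean (s : ι → E) : E := (Fintype.card ι : ℝ)⁻¹ • ∑ i, s i

theorem mean_const [Nonempty ι] (x : E) : mean (fun _ : ι => x) = x := by
  rw [mean, Finset.sum_const, Finset.card_univ, ← Nat.cast_smul_eq_nsmul ℝ, smul_smul,
    inv_mul_cancel₀ (by positivity), one_smul]

theorem mean_sub (s r : ι → E) : mean (fun i => s i - r i) = mean s - mean r := by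
  simp only [mean, Finset.sum_sub_distrib, smul_sub]

theorem norm_mean_le (s : ι → E) : ‖mean s‖ ≤ 𝔼 i, ‖s i‖ := by
  rw [mean, norm_smul, norm_inv, RCLike.norm_natCast, Fintype.expect_eq_sum_div_card,
    div_eq_inv_mul]
  gcongr
  exact norm_sum_le _ _

theorem norm_mean_pow_le [Nonempty ι] (s : ι → E) (q : ℕ) : ‖mean s‖ ^ q ≤ 𝔼 i, ‖s i‖ ^ q :=
  (pow_le_pow_left₀ (norm_nonneg _) (norm_mean_le s) q).trans
    (pow_expect_le (fun _ => norm_nonneg _) q)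

theorem sub_mean [Nonempty ι] (s : ι → E) (x : E) : x - mean s = mean fun j => x - s j := by
  rw [mean_sub, mean_const]

theorem expect_norm_sub_mean_pow_le [Nonempty ι] (s : ι → E) (q : ℕ) :
    𝔼 i, ‖s i - mean s‖ ^ q ≤ spread q s :=
  Finset.expect_le_expect fun i _ => by
    rw [sub_mean]
    exact norm_mean_pow_le _ q

end Averages

section PowerInequalities

theorem add_sq_le_young {θ : ℝ} (hθ : 0 < θ) (a b : ℝ) :
    (a + b) ^ 2 ≤ (1 + θ) * a ^ 2 + (1 + 1 / θ) * b ^ 2 := by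
  have hgap : (1 + θ) * a ^ 2 + (1 + 1 / θ) * b ^ 2 - (a + b) ^ 2 = (θ * a - b) ^ 2 / θ := by
    field_simp; ring
  have hgap_nonneg : 0 ≤ (θ * a - b) ^ 2 / θ := by positivity
  linarith

theorem add_pow_four_le_young {θ : ℝ} (hθ : 0 < θ) (a b : ℝ) :
    (a + b) ^ 4 ≤ (1 + θ) ^ 3 * a ^ 4 + (1 + 1 / θ) ^ 3 * b ^ 4 :=
  calc (a + b) ^ 4 = ((a + b) ^ 2) ^ 2 := by ring
    _ ≤ ((1 + θ) * a ^ 2 + (1 + 1 / θ) * b ^ 2) ^ 2 := by gcongr; exact add_sq_le_young hθ a b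
    _ ≤ (1 + θ) * ((1 + θ) * a ^ 2) ^ 2 + (1 + 1 / θ) * ((1 + 1 / θ) * b ^ 2) ^ 2 :=
        add_sq_le_young hθ _ _
    _ = _ := by ring

theorem add_four_sq_le (a b c e : ℝ) :
    (a + b + c + e) ^ 2 ≤ 4 * (a ^ 2 + b ^ 2 + c ^ 2 + e ^ 2) := by
  nlinarith [sq_nonneg (a - b), sq_nonneg (a - c), sq_nonneg (a - e), sq_nonneg (b - c),
    sq_nonneg (b - e), sq_nonneg (c - e)]

theorem add_four_pow_four_le (a b c e : ℝ) :
    (a + b + c + e) ^ 4 ≤ 64 * (a ^ 4 + b ^ 4 + c ^ 4 + e ^ 4) :=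
  calc (a + b + c + e) ^ 4 = ((a + b + c + e) ^ 2) ^ 2 := by ring
    _ ≤ (4 * (a ^ 2 + b ^ 2 + c ^ 2 + e ^ 2)) ^ 2 := by gcongr; exact add_four_sq_le a b c e
    _ = 16 * (a ^ 2 + b ^ 2 + c ^ 2 + e ^ 2) ^ 2 := by ring
    _ ≤ 16 * (4 * ((a ^ 2) ^ 2 + (b ^ 2) ^ 2 + (c ^ 2) ^ 2 + (e ^ 2) ^ 2)) := by
        gcongr; exact add_four_sq_le _ _ _ _
    _ = _ := by ring

end PowerInequalities

section Chain

variable {d M : ℕ} {Z : Type*} [MeasurableSpace Z]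

/-- One local stochastic gradient step on every machine. -/
def localStep (P : Problem d M Z) (η : ℝ) (s : Fin M → Space d) (w : Fin M → Z) :
    Fin M → Space d :=
  fun m => s m - η • P.g m (s m) (w m)

/-- One step of the Markov chain of local models, with averaging when `b` holds. -/
def chainStep (P : Problem d M Z) (η : ℝ) (b : Prop) [Decidable b] (s : Fin M → Space d)
    (w : Fin M → Z) : Fin M → Space d :=
  if b then fun _ => mean (localStep P η s w) else localStep P η s w

theorem localIterate_succ (P : Problem d M Z) (K : ℕ) (η : ℝ) (z : ℕ → Fin M → Z) (t : ℕ) :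
    P.localIterate K η z (t + 1) =
      chainStep P η ((t + 1) % K = 0) (P.localIterate K η z t) (z t) := by
  ext1 m
  simp only [Problem.localIterate, chainStep, mean, localStep, Fintype.card_fin, one_div]
  split_ifs <;> rfl

theorem iterate_eq_mean (P : Problem d M Z) (K : ℕ) (η : ℝ) (z : ℕ → Fin M → Z) (t : ℕ) :
    P.iterate K η z t = mean (P.localIterate K η z t) := by
  rw [Problem.iterate, mean, Fintype.card_fin, one_div]

theorem mean_chainStep (hM : 0 < M) (P : Problem d M Z) (η : ℝ) (b : Prop) [Decidable b]
    (s : Fin M → Space d) (w : Fin M → Z) :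
    mean (chainStep P η b s w) = mean (localStep P η s w) := by
  have : Nonempty (Fin M) := Fin.pos_iff_nonempty.1 hM
  unfold chainStep
  split_ifs
  · exact mean_const _
  · rfl

theorem measurable_mean : Measurable (mean : (Fin M → Space d) → Space d) := by
  unfold mean
  fun_prop

theorem measurable_localStep {P : Problem d M Z}
    (hg : ∀ m, Measurable (Function.uncurry (P.g m))) (η : ℝ) :
    Measurable (Function.uncurry (localStep P η)) := by
  refine measurable_pi_lambda _ fun m => ?_
  have horacle : Measurable (fun sw : (Fin M → Space d) × (Fin M → Z) =>
      P.g m (sw.1 m) (sw.2 m)) :=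
    (hg m).comp (f := fun sw : (Fin M → Space d) × (Fin M → Z) => (sw.1 m, sw.2 m)) (by fun_prop)
  exact Measurable.sub (by fun_prop) (horacle.const_smul η)

theorem measurable_chainStep {P : Problem d M Z}
    (hg : ∀ m, Measurable (Function.uncurry (P.g m))) (η : ℝ) (b : Prop) [Decidable b] :
    Measurable (Function.uncurry (chainStep P η b)) := by
  unfold chainStep
  split_ifs
  · exact measurable_pi_lambda _ fun _ => measurable_mean.comp (measurable_localStep hg η)
  · exact measurable_localStep hg η

variable {Ω : Type*} {z : ℕ → Fin M → Ω → Z}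

theorem measurable_localIterate_past {P : Problem d M Z}
    (hg : ∀ m, Measurable (Function.uncurry (P.g m))) (K : ℕ) (η : ℝ) (t : ℕ) :
    Measurable[⨆ i ∈ {i : ℕ × Fin M | i.1 < t}, MeasurableSpace.comap (z i.1 i.2) inferInstance]
      (fun ω => P.localIterate K η (fun t m => z t m ω) t) := by
  induction t with
  | zero => exact measurable_const
  | succ t ih =>
    simp_rw [localIterate_succ]
    refine (measurable_chainStep hg η _).comp (Measurable.prodMk (ih.mono ?_ le_rfl) ?_)
    · exact biSup_mono fun i (hi : i.1 < t) => Nat.lt_succ_of_lt hi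
    · refine @measurable_pi_lambda _ _ _ (_) _ _ fun m => (comap_measurable (z t m)).mono ?_ le_rfl
      exact le_biSup (fun i : ℕ × Fin M => MeasurableSpace.comap (z i.1 i.2) inferInstance)
        (show (t, m) ∈ {i : ℕ × Fin M | i.1 < t + 1} from Nat.lt_succ_self t)

variable [MeasurableSpace Ω] {Pr : Measure Ω} {D : Fin M → Measure Z}

theorem IsSampling.map_eq_pi (hz : IsSampling Pr D z) (t : ℕ) :
    Measure.map (fun ω m => z t m ω) Pr = Measure.pi D := by
  have hindep := hz.indep.precomp (g := fun m : Fin M => (t, m)) (fun a b h => by simpa using h)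
  rw [hindep.map_fun_eq_pi_map fun m => (hz.measurable t m).aemeasurable]
  simp [hz.law]

theorem IsSampling.measurable_localIterate (hz : IsSampling Pr D z) {P : Problem d M Z}
    (hg : ∀ m, Measurable (Function.uncurry (P.g m))) (K : ℕ) (η : ℝ) (t : ℕ) :
    Measurable (fun ω => P.localIterate K η (fun t m => z t m ω) t) :=
  (measurable_localIterate_past (z := z) hg K η t).mono
    (iSup₂_le fun i _ => (hz.measurable i.1 i.2).comap_le) le_rfl

theorem IsSampling.indepFun_localIterate (hz : IsSampling Pr D z) {P : Problem d M Z}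
    (hg : ∀ m, Measurable (Function.uncurry (P.g m))) (K : ℕ) (η : ℝ) (t : ℕ) :
    IndepFun (fun ω => P.localIterate K η (fun t m => z t m ω) t) (fun ω m => z t m ω) Pr := by
  have hpast_present := indep_iSup_of_disjoint
    (fun i : ℕ × Fin M => (hz.measurable i.1 i.2).comap_le)
    hz.indep.iIndep (S := {i | i.1 < t}) (T := {i | i.1 = t})
    (Set.disjoint_left.2 fun i (hlt : i.1 < t) (heq : i.1 = t) => hlt.ne heq)
  rw [IndepFun_iff_Indep]
  refine indep_of_indep_of_le_left (indep_of_indep_of_le_right hpast_present ?_)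
    (measurable_localIterate_past hg K η t).comap_le
  refine Measurable.comap_le (@measurable_pi_lambda _ _ _ (_) _ _ fun m =>
    (comap_measurable (z t m)).mono ?_ le_rfl)
  exact le_biSup (fun i : ℕ × Fin M => MeasurableSpace.comap (z i.1 i.2) inferInstance)
    (show (t, m) ∈ {i : ℕ × Fin M | i.1 = t} from rfl)

theorem IsSampling.hasMeanLE_localIterate_succ [IsProbabilityMeasure Pr]
    [∀ m, IsProbabilityMeasure (D m)] (hz : IsSampling Pr D z) {P : Problem d M Z}
    (hg : ∀ m, Measurable (Function.uncurry (P.g m))) (K : ℕ) (η : ℝ) (t : ℕ)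
    {f ψ : (Fin M → Space d) → ℝ} (hf : Measurable f) (hf0 : 0 ≤ f) (hψ : Measurable ψ)
    (hfψ : ∀ s, HasMeanLE (Measure.pi D)
      (fun w => f (chainStep P η ((t + 1) % K = 0) s w)) (ψ s)) {c : ℝ}
    (hψc : HasMeanLE Pr (fun ω => ψ (P.localIterate K η (fun t m => z t m ω) t)) c) :
    HasMeanLE Pr (fun ω => f (P.localIterate K η (fun t m => z t m ω) (t + 1))) c := by
  simp_rw [localIterate_succ]
  exact hasMeanLE_comp_of_indep (hz.measurable_localIterate hg K η t)
    (measurable_pi_lambda _ fun m => hz.measurable t m) (hz.map_eq_pi t)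
    (hz.indepFun_localIterate hg K η t)
    (φ := fun s w => f (chainStep P η ((t + 1) % K = 0) s w))
    (hf.comp (measurable_chainStep hg η _)) (fun _ _ => hf0 _) hψ hfψ hψc

end Chain

section Drift

variable {d M : ℕ} {Z : Type*} [MeasurableSpace Z] {P : Problem d M Z} {H μ η Q τ : ℝ}

/-- The deviation of the average of the local gradients from the gradient of the average objective
at the average model. -/
def gradBias (P : Problem d M Z) (s : Fin M → Space d) : Space d :=
  mean fun m => gradient (P.F m) (s m) - gradient (P.F m) (mean s)

/-- The error, relative to `xs`, of the averaged model after a noiseless step from `s`. -/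
def meanDrift (P : Problem d M Z) (xs : Space d) (η : ℝ) (s : Fin M → Space d) : Space d :=
  mean (fun m => s m - η • gradient (P.F m) (s m)) - xs

theorem norm_gradBias_pow_four_le [Nonempty (Fin M)] (hH : P.SmoothSecond H)
    (s : Fin M → Space d) : ‖gradBias P s‖ ^ 4 ≤ H ^ 4 * spread 4 s :=
  calc ‖gradBias P s‖ ^ 4
      ≤ 𝔼 m, ‖gradient (P.F m) (s m) - gradient (P.F m) (mean s)‖ ^ 4 := norm_mean_pow_le _ 4
    _ ≤ 𝔼 m, H ^ 4 * ‖s m - mean s‖ ^ 4 := Finset.expect_le_expect fun m _ => by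
        rw [← mul_pow]
        exact pow_le_pow_left₀ (norm_nonneg _) ((hH m).2 _ _) 4
    _ ≤ H ^ 4 * spread 4 s := by
        rw [← Finset.mul_expect]
        gcongr
        exact expect_norm_sub_mean_pow_le s 4

/-- Subtracting the average Hessian applied to `s m - mean s`, which sums to zero over the
machines, turns the bias into a second-order Taylor remainder. -/
theorem gradBias_eq_mean_remainder [Nonempty (Fin M)] (A : Space d →L[ℝ] Space d)
    (s : Fin M → Space d) :
    gradBias P s = mean fun m =>
      gradient (P.F m) (s m) - gradient (P.F m) (mean s) - A (s m - mean s) := by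
  have hzero : mean (fun m => A (s m - mean s)) = 0 := by
    have hmap : mean (fun m => A (s m - mean s)) = A (mean fun m => s m - mean s) := by
      simp only [mean, map_smul, map_sum]
    rw [hmap, mean_sub, mean_const, sub_self, map_zero]
  rw [mean_sub _ (fun m => A (s m - mean s)), hzero, sub_zero, gradBias]

theorem norm_gradBias_sq_le [Nonempty (Fin M)] (hQ0 : 0 ≤ Q) (hQ : P.SmoothThird Q)
    (hτ : P.HessianHeterogeneity τ) (s : Fin M → Space d) :
    ‖gradBias P s‖ ^ 2 ≤ 2 * τ ^ 2 * spread 2 s + 2 * Q ^ 2 * spread 4 s := by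
  set A := mean fun n => hessian (P.F n) (mean s)
  have hA (m : Fin M) : ‖fderiv ℝ (gradient (P.F m)) (mean s) - A‖ ≤ τ := by
    rw [sub_mean]
    calc _ ≤ 𝔼 n, ‖hessian (P.F m) (mean s) - hessian (P.F n) (mean s)‖ := norm_mean_le _
      _ ≤ 𝔼 _n : Fin M, τ := Finset.expect_le_expect fun n _ => hτ m n _
      _ = τ := Fintype.expect_const τ
  have hremainder (m : Fin M) :
      ‖gradient (P.F m) (s m) - gradient (P.F m) (mean s) - A (s m - mean s)‖ ^ 2 ≤
        2 * τ ^ 2 * ‖s m - mean s‖ ^ 2 + 2 * Q ^ 2 * ‖s m - mean s‖ ^ 4 := by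
    refine (pow_le_pow_left₀ (norm_nonneg _) (norm_gradient_sub_gradient_sub_apply_le
      (hQ m).1 hQ0 (hQ m).2 (hA m) (s m)) 2).trans ?_
    nlinarith [sq_nonneg (τ * ‖s m - mean s‖ - Q * ‖s m - mean s‖ ^ 2)]
  rw [gradBias_eq_mean_remainder A]
  calc _ ≤ 𝔼 m, ‖gradient (P.F m) (s m) - gradient (P.F m) (mean s) - A (s m - mean s)‖ ^ 2 :=
        norm_mean_pow_le _ 2
    _ ≤ 𝔼 m, (2 * τ ^ 2 * ‖s m - mean s‖ ^ 2 + 2 * Q ^ 2 * ‖s m - mean s‖ ^ 4) :=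
        Finset.expect_le_expect fun m _ => hremainder m
    _ ≤ 2 * τ ^ 2 * spread 2 s + 2 * Q ^ 2 * spread 4 s := by
        rw [Finset.expect_add_distrib, ← Finset.mul_expect, ← Finset.mul_expect]
        gcongr <;> exact expect_norm_sub_mean_pow_le s _

theorem mean_gradient_eq_zero (hM : 0 < M) (hF : ∀ m, Differentiable ℝ (P.F m)) {xs : Space d}
    (hxs : xs ∈ optima P.avg) : mean (fun m => gradient (P.F m) xs) = 0 := by
  have hderiv : HasFDerivAt P.avg ((1 / (M : ℝ)) • ∑ m, fderiv ℝ (P.F m) xs) xs :=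
    (HasFDerivAt.fun_sum fun m _ => (hF m xs).hasFDerivAt).const_mul (1 / (M : ℝ))
  have hcrit : fderiv ℝ P.avg xs = 0 :=
    (IsMinOn.isLocalMin (s := Set.univ) hxs Filter.univ_mem).fderiv_eq_zero
  rw [hderiv.fderiv] at hcrit
  have hsum := (smul_eq_zero.1 hcrit).resolve_left (by positivity)
  simp only [mean, gradient, ← map_sum, hsum, map_zero, smul_zero]

theorem IsStronglyConvex.exists_optima_eq_singleton {f : Space d → ℝ} (hμ : 0 < μ)
    (hsc : IsStronglyConvex μ f) : ∃ x, optima f = {x} := by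
  obtain ⟨x, hx⟩ := hsc.exists_isMinOn hμ
  exact ⟨x, Set.eq_singleton_iff_unique_mem.2 ⟨hx, fun y hy => hsc.eq_of_isMinOn hμ hy hx⟩⟩

theorem zetaPair_eq {xm : Fin M → Space d} (hxm : ∀ m, optima (P.F m) = {xm m}) (m n : Fin M) :
    P.zetaPair m n = ‖xm m - xm n‖ := by
  simp [Problem.zetaPair, hxm]

theorem norm_meanDrift_le [Nonempty (Fin M)] (hsc : P.StronglyConvex μ) (hH : P.SmoothSecond H)
    (hH0 : 0 < H) (hμ : 0 ≤ μ) (hμH : μ ≤ H) (hη : 0 ≤ η) (hηH : η ≤ 1 / (2 * H)) {xs : Space d}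
    (hxs : mean (fun m => gradient (P.F m) xs) = 0) (s : Fin M → Space d) :
    ‖meanDrift P xs η s‖ ≤ (1 - η * μ) * ‖mean s - xs‖ + η * ‖gradBias P s‖ := by
  have hsmul (r : Fin M → Space d) : mean (fun m => η • r m) = η • mean r := by
    simp only [mean, ← Finset.smul_sum, smul_comm η]
  have hsplit : meanDrift P xs η s = mean (fun m => (mean s - η • gradient (P.F m) (mean s)) -
      (xs - η • gradient (P.F m) xs)) - η • gradBias P s := by
    simp only [meanDrift, gradBias, mean_sub, mean_const, hsmul, hxs]
    module
  rw [hsplit]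
  refine (norm_sub_le _ _).trans (add_le_add ?_ ?_)
  · calc _ ≤ 𝔼 m, ‖(mean s - η • gradient (P.F m) (mean s)) - (xs - η • gradient (P.F m) xs)‖ :=
          norm_mean_le _
      _ ≤ 𝔼 _m : Fin M, (1 - η * μ) * ‖mean s - xs‖ := Finset.expect_le_expect fun m _ =>
          IsStronglyConvex.norm_gradientStep_sub_le (hsc m) (hH m) hH0 hμ hμH hη hηH _ _
      _ = _ := Fintype.expect_const _
  · rw [norm_smul, Real.norm_of_nonneg hη]

theorem norm_gradient_sub_gradient_le (hH : P.SmoothSecond H) (hC2 : ∀ m, ContDiff ℝ 2 (P.F m))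
    (hτ : P.HessianHeterogeneity τ) {xm : Fin M → Space d}
    (hxm : ∀ m, gradient (P.F m) (xm m) = 0) (x : Space d) (m n : Fin M) :
    ‖gradient (P.F m) x - gradient (P.F n) x‖ ≤ H * ‖xm m - xm n‖ + τ * ‖x - xm m‖ := by
  have hhet := norm_gradient_sub_gradient_sub_le (hC2 m) (hC2 n) (hτ m n) x (xm m)
  have hlip := (hH n).2 (xm m) (xm n)
  rw [hxm m, zero_sub, sub_neg_eq_add] at hhet
  rw [hxm n, sub_zero] at hlip
  rw [← add_sub_cancel_right (gradient (P.F m) x - gradient (P.F n) x) (gradient (P.F n) (xm m)),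
    add_comm (H * _)]
  exact norm_sub_le_of_le hhet hlip

theorem norm_pairDrift_le (hsc : P.StronglyConvex μ) (hH : P.SmoothSecond H)
    (hC2 : ∀ m, ContDiff ℝ 2 (P.F m)) (hτ : P.HessianHeterogeneity τ) (hH0 : 0 < H) (hμ : 0 ≤ μ)
    (hμH : μ ≤ H) (hτ0 : 0 ≤ τ) (hη : 0 ≤ η) (hηH : η ≤ 1 / (2 * H)) {xm : Fin M → Space d}
    (hxm : ∀ m, gradient (P.F m) (xm m) = 0) (xs : Space d) (s : Fin M → Space d) (m n : Fin M) :
    ‖(s m - η • gradient (P.F m) (s m)) - (s n - η • gradient (P.F n) (s n))‖ ≤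
      (1 - η * μ) * ‖s m - s n‖ + η * (H * ‖xm m - xm n‖ + τ * ‖xs - xm m‖ + τ * ‖mean s - xs‖ +
        τ * ‖s n - mean s‖) := by
  have hsplit : (s m - η • gradient (P.F m) (s m)) - (s n - η • gradient (P.F n) (s n)) =
      ((s m - η • gradient (P.F m) (s m)) - (s n - η • gradient (P.F m) (s n))) -
        η • (gradient (P.F m) (s n) - gradient (P.F n) (s n)) := by
    module
  have hdist : ‖s n - xm m‖ ≤ ‖xs - xm m‖ + ‖mean s - xs‖ + ‖s n - mean s‖ := by
    rw [show s n - xm m = (xs - xm m) + (mean s - xs) + (s n - mean s) by abel]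
    exact norm_add₃_le
  rw [hsplit]
  refine (norm_sub_le _ _).trans (add_le_add
    (IsStronglyConvex.norm_gradientStep_sub_le (hsc m) (hH m) hH0 hμ hμH hη hηH _ _) ?_)
  rw [norm_smul, Real.norm_of_nonneg hη]
  gcongr
  calc _ ≤ H * ‖xm m - xm n‖ + τ * ‖s n - xm m‖ :=
        norm_gradient_sub_gradient_le hH hC2 hτ hxm _ m n
    _ ≤ H * ‖xm m - xm n‖ + τ * (‖xs - xm m‖ + ‖mean s - xs‖ + ‖s n - mean s‖) := by gcongr
    _ = _ := by ring

end Drift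

section Noise

variable {d M : ℕ} {Z : Type*} [MeasurableSpace Z] {P : Problem d M Z} {v b : Fin M → ℝ}

/-- The noise of the stochastic gradient of machine `m` at `x` on the datum `y`. -/
def noise (P : Problem d M Z) (m : Fin M) (x : Space d) (y : Z) : Space d :=
  P.g m x y - gradient (P.F m) x

/-- The oracle noise of machine `m` has, at every point, second moment at most `v m` and fourth
moment at most `b m`. Unlike in `Problem.NoiseMoment`, no power is taken of `v m` and `b m`. -/
structure NoiseBound (P : Problem d M Z) (v b : Fin M → ℝ) : Prop where
  memLp : ∀ m x, MemLp (noise P m x) 4 (P.D m)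
  second : ∀ m x, ∫ y, ‖noise P m x y‖ ^ 2 ∂(P.D m) ≤ v m
  fourth : ∀ m x, ∫ y, ‖noise P m x y‖ ^ 4 ∂(P.D m) ≤ b m

theorem measurable_noise (ho : P.UnbiasedOracle) (m : Fin M) (x : Space d) :
    Measurable (noise P m x) :=
  ((ho m).2.1.comp measurable_prodMk_left).sub_const _

theorem integral_noise (ho : P.UnbiasedOracle) (m : Fin M) (x : Space d) :
    ∫ y, noise P m x y ∂(P.D m) = 0 := by
  obtain ⟨_, -, hg⟩ := ho m
  simp only [noise]
  rw [integral_sub (hg x).1 (integrable_const _), (hg x).2]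
  simp

theorem memLp_noise (ho : P.UnbiasedOracle) {m : Fin M} {x : Space d}
    (hint : Integrable (fun y => ‖noise P m x y‖ ^ 4) (P.D m)) :
    MemLp (noise P m x) 4 (P.D m) := by
  refine (integrable_norm_rpow_iff (measurable_noise ho m x).aestronglyMeasurable (by norm_num)
    (by norm_num)).1 (hint.congr (.of_forall fun y => ?_))
  simp only [ENNReal.toReal_ofNat]
  exact (Real.rpow_natCast _ 4).symm

theorem exists_noiseBound (ho : P.UnbiasedOracle) {σ₂ σ₄ : ℝ} (hσ₂ : P.NoiseMoment 2 σ₂)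
    (hσ₄ : P.NoiseMoment 4 σ₄) :
    ∃ s₂ s₄ : Fin M → ℝ, 𝔼 m, s₂ m ^ 2 ≤ σ₂ ^ 2 ∧ 𝔼 m, s₄ m ^ 4 ≤ σ₄ ^ 4 ∧
      NoiseBound P (fun m => s₂ m ^ 2) (fun m => s₄ m ^ 4) ∧
      NoiseBound P (fun m => s₄ m ^ 2) (fun m => s₄ m ^ 4) := by
  obtain ⟨s₂, -, havg₂, hbound₂⟩ := hσ₂
  obtain ⟨s₄, -, havg₄, hbound₄⟩ := hσ₄
  have hL (m x) : MemLp (noise P m x) 4 (P.D m) := memLp_noise ho (hbound₄ m x).1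
  refine ⟨s₂, s₄, ?_, ?_, ⟨hL, fun m x => (hbound₂ m x).2, fun m x => (hbound₄ m x).2⟩,
    ⟨hL, fun m x => ?_, fun m x => (hbound₄ m x).2⟩⟩
  · simpa [Fintype.expect_eq_sum_div_card, div_eq_inv_mul] using havg₂
  · simpa [Fintype.expect_eq_sum_div_card, div_eq_inv_mul] using havg₄
  have := (ho m).1
  have hpow (y : Z) : (‖noise P m x y‖ ^ 2) ^ 2 = ‖noise P m x y‖ ^ 4 := by ring
  have hjensen := sq_integral_le (ν := P.D m) (f := fun y => ‖noise P m x y‖ ^ 2)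
    ((memLp_two_iff_integrable_sq
      ((measurable_noise ho m x).norm.pow_const 2).aestronglyMeasurable).2
      ((hbound₄ m x).1.congr (.of_forall fun y => (hpow y).symm)))
  simp only [hpow] at hjensen
  have hsq : (s₄ m ^ 2) ^ 2 = s₄ m ^ 4 := by ring
  exact (abs_le_of_sq_le_sq' ((hjensen.trans (hbound₄ m x).2).trans_eq hsq.symm) (sq_nonneg _)).2

theorem integral_norm_smul_noise_pow_le (ho : P.UnbiasedOracle) {m : Fin M} {x : Space d} {q : ℕ}
    (hq : Even q) {c : ℝ} (hc : ∫ y, ‖noise P m x y‖ ^ q ∂(P.D m) ≤ c) (a : ℝ) :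
    ∫ w : Fin M → Z, ‖a • noise P m x (w m)‖ ^ q ∂(Measure.pi P.D) ≤ a ^ q * c := by
  have := fun m => (ho m).1
  rw [integral_comp_eval (μ := P.D) (i := m) (f := fun y => ‖a • noise P m x y‖ ^ q)
    (((measurable_noise ho m x).const_smul a).norm.pow_const q).aestronglyMeasurable]
  simp only [norm_smul, mul_pow, Real.norm_eq_abs, integral_const_mul, hq.pow_abs]
  exact mul_le_mul_of_nonneg_left hc (hq.pow_nonneg a)

section WeightedSum

variable (ho : P.UnbiasedOracle) (hN : NoiseBound P v b) (s : Fin M → Space d) (a : Fin M → ℝ)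
include ho

theorem iIndepFun_smul_noise :
    iIndepFun (fun m (w : Fin M → Z) => a m • noise P m (s m) (w m)) (Measure.pi P.D) :=
  have := fun m => (ho m).1
  iIndepFun_pi (X := fun m y => a m • noise P m (s m) y)
    fun m => ((measurable_noise ho m (s m)).const_smul (a m)).aemeasurable

theorem measurable_smul_noise (m : Fin M) :
    Measurable fun w : Fin M → Z => a m • noise P m (s m) (w m) :=
  ((measurable_noise ho m (s m)).comp (measurable_pi_apply m)).const_smul (a m)

theorem integral_smul_noise (m : Fin M) :
    ∫ w : Fin M → Z, a m • noise P m (s m) (w m) ∂(Measure.pi P.D) = 0 := by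
  have := fun m => (ho m).1
  rw [integral_smul, integral_comp_eval (μ := P.D) (i := m) (f := noise P m (s m))
    (measurable_noise ho m (s m)).aestronglyMeasurable, integral_noise ho, smul_zero]

include hN

theorem memLp_smul_noise (m : Fin M) :
    MemLp (fun w : Fin M → Z => a m • noise P m (s m) (w m)) 4 (Measure.pi P.D) :=
  have := fun m => (ho m).1
  ((hN.memLp m (s m)).const_smul (a m)).comp_measurePreserving (measurePreserving_eval P.D m)

theorem memLp_add_sum_noise (u : Space d) :
    MemLp (fun w : Fin M → Z => u + ∑ m, a m • noise P m (s m) (w m)) 4 (Measure.pi P.D) :=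
  have := fun m => (ho m).1
  (memLp_const u).add (memLp_finsetSum _ fun m _ => memLp_smul_noise ho hN s a m)

theorem hasMeanLE_norm_add_sum_noise_sq (u : Space d) :
    HasMeanLE (Measure.pi P.D) (fun w => ‖u + ∑ m, a m • noise P m (s m) (w m)‖ ^ 2)
      (‖u‖ ^ 2 + ∑ m, a m ^ 2 * v m) := by
  have := fun m => (ho m).1
  refine ⟨((memLp_add_sum_noise ho hN s a u).mono_exponent (p := 2)
    (by norm_num)).integrable_norm_pow two_ne_zero, ?_⟩
  rw [integral_norm_add_sum_sq (iIndepFun_smul_noise ho s a) (measurable_smul_noise ho s a)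
    (fun m => (memLp_smul_noise ho hN s a m).mono_exponent (by norm_num))
    (integral_smul_noise ho s a)]
  gcongr with m
  exact integral_norm_smul_noise_pow_le ho even_two (hN.second m (s m)) (a m)

theorem hasMeanLE_norm_add_sum_noise_pow_four (u : Space d) :
    HasMeanLE (Measure.pi P.D) (fun w => ‖u + ∑ m, a m • noise P m (s m) (w m)‖ ^ 4)
      (‖u‖ ^ 4 + 8 * ‖u‖ ^ 2 * (∑ m, a m ^ 2 * v m) + 8 * (∑ m, a m ^ 2 * v m) ^ 2 +
        3 * ∑ m, a m ^ 4 * b m) := by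
  have := fun m => (ho m).1
  have hvar : ∑ m, ∫ w : Fin M → Z, ‖a m • noise P m (s m) (w m)‖ ^ 2 ∂(Measure.pi P.D) ≤
      ∑ m, a m ^ 2 * v m :=
    Finset.sum_le_sum fun m _ =>
      integral_norm_smul_noise_pow_le ho even_two (hN.second m (s m)) (a m)
  have hfourth : ∑ m, ∫ w : Fin M → Z, ‖a m • noise P m (s m) (w m)‖ ^ 4 ∂(Measure.pi P.D) ≤
      ∑ m, a m ^ 4 * b m :=
    Finset.sum_le_sum fun m _ =>
      integral_norm_smul_noise_pow_le ho (by decide) (hN.fourth m (s m)) (a m)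
  have :
      0 ≤ ∑ m, ∫ w : Fin M → Z, ‖a m • noise P m (s m) (w m)‖ ^ 2 ∂(Measure.pi P.D) :=
    Finset.sum_nonneg fun m _ => integral_nonneg fun w => by positivity
  refine ⟨(memLp_add_sum_noise ho hN s a u).integrable_norm_pow (p := 4) four_ne_zero,
    (integral_norm_add_sum_pow_four_le (iIndepFun_smul_noise ho s a)
      (measurable_smul_noise ho s a) (memLp_smul_noise ho hN s a)
      (integral_smul_noise ho s a) u Finset.univ).trans ?_⟩
  gcongr

end WeightedSum

end Noise

section NoisyStep

variable {d M : ℕ} {Z : Type*} [MeasurableSpace Z] {P : Problem d M Z} {v b : Fin M → ℝ}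

theorem moment_four_le_of_young {θ U S T V w W : ℝ} (hθ : 0 < θ) (hUT : U ^ 4 ≤ T)
    (hSV : S ^ 2 ≤ V) (hwW : w ≤ W) :
    U ^ 4 + 8 * U ^ 2 * S + 8 * S ^ 2 + 3 * w ≤ (1 + θ) * T + (16 / θ + 8) * V + 3 * W := by
  have hgap : θ * U ^ 4 + 16 / θ * S ^ 2 - 8 * U ^ 2 * S = (θ * U ^ 2 - 4 * S) ^ 2 / θ := by
    field_simp; ring
  have hgap_nonneg : 0 ≤ (θ * U ^ 2 - 4 * S) ^ 2 / θ := by positivity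
  calc _ ≤ (1 + θ) * U ^ 4 + (16 / θ + 8) * S ^ 2 + 3 * w := by linarith
    _ ≤ _ := by gcongr

variable (ho : P.UnbiasedOracle) (hN : NoiseBound P v b) (s : Fin M → Space d) {a : Fin M → ℝ}
  {θ : ℝ} {u : Space d} {A B : ℝ}
include ho hN

theorem hasMeanLE_norm_add_sum_noise_sq_of_norm_le (hθ : 0 < θ) (hu : ‖u‖ ≤ A + B) {V : ℝ}
    (hV : ∑ m, a m ^ 2 * v m ≤ V) :
    HasMeanLE (Measure.pi P.D) (fun w => ‖u + ∑ m, a m • noise P m (s m) (w m)‖ ^ 2)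
      ((1 + θ) * A ^ 2 + (1 + 1 / θ) * B ^ 2 + V) :=
  (hasMeanLE_norm_add_sum_noise_sq ho hN s a u).trans_le <| add_le_add
    ((pow_le_pow_left₀ (norm_nonneg _) hu 2).trans (add_sq_le_young hθ A B)) hV

theorem hasMeanLE_norm_add_sum_noise_pow_four_of_norm_le (hθ : 0 < θ) (hu : ‖u‖ ≤ A + B) {V W : ℝ}
    (hV : (∑ m, a m ^ 2 * v m) ^ 2 ≤ V) (hW : ∑ m, a m ^ 4 * b m ≤ W) :
    HasMeanLE (Measure.pi P.D) (fun w => ‖u + ∑ m, a m • noise P m (s m) (w m)‖ ^ 4)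
      ((1 + θ) ^ 4 * A ^ 4 + (1 + θ) * (1 + 1 / θ) ^ 3 * B ^ 4 + ((16 / θ + 8) * V + 3 * W)) := by
  have hu4 : ‖u‖ ^ 4 ≤ (1 + θ) ^ 3 * A ^ 4 + (1 + 1 / θ) ^ 3 * B ^ 4 :=
    (pow_le_pow_left₀ (norm_nonneg _) hu 4).trans (add_pow_four_le_young hθ A B)
  exact (hasMeanLE_norm_add_sum_noise_pow_four ho hN s a u).trans_le
    ((moment_four_le_of_young hθ hu4 hV hW).trans_eq (by ring))

end NoisyStep

section StepDecomposition

variable {d M : ℕ} {Z : Type*} [MeasurableSpace Z]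

theorem mean_localStep_sub (P : Problem d M Z) (xs : Space d) (η : ℝ) (s : Fin M → Space d)
    (w : Fin M → Z) :
    mean (localStep P η s w) - xs =
      meanDrift P xs η s + ∑ m, (-(η / (M : ℝ))) • noise P m (s m) (w m) := by
  have hstep : localStep P η s w =
      fun m => (s m - η • gradient (P.F m) (s m)) - η • noise P m (s m) (w m) := by
    ext1 m
    simp only [localStep, noise]
    module
  rw [hstep, mean_sub, meanDrift, mean, mean, Fintype.card_fin, ← Finset.smul_sum,
    ← Finset.smul_sum, smul_smul, neg_smul, div_eq_inv_mul]
  abel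

theorem localStep_sub (P : Problem d M Z) (η : ℝ) (s : Fin M → Space d) (w : Fin M → Z)
    (m n : Fin M) :
    localStep P η s w m - localStep P η s w n =
      ((s m - η • gradient (P.F m) (s m)) - (s n - η • gradient (P.F n) (s n))) +
        ∑ i, (η * ((if i = n then 1 else 0) - (if i = m then 1 else 0))) •
          noise P i (s i) (w i) := by
  simp only [mul_sub, sub_smul, Finset.sum_sub_distrib, mul_ite, mul_one, mul_zero, ite_smul,
    zero_smul, Finset.sum_ite_eq', Finset.mem_univ, if_true]
  simp only [localStep, noise]
  module

theorem sum_mean_weights_pow_le {η c : ℝ} (hη : 0 ≤ η) {v : Fin M → ℝ} (hv : 𝔼 m, v m ≤ c) {k : ℕ}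
    (hk : Even (k + 1)) :
    ∑ m, (-(η / (M : ℝ))) ^ (k + 1) * v m ≤ η ^ (k + 1) * c / (M : ℝ) ^ k := by
  have hsum : ∑ m, (-(η / (M : ℝ))) ^ (k + 1) * v m = η ^ (k + 1) * (𝔼 m, v m) / (M : ℝ) ^ k := by
    rw [← Finset.mul_sum, hk.neg_pow, div_pow, Fintype.expect_eq_sum_div_card, Fintype.card_fin]
    ring
  rw [hsum]
  gcongr

theorem sum_pair_weights_pow_le (η : ℝ) (m n : Fin M) {v : Fin M → ℝ} (hv : ∀ i, 0 ≤ v i) {q : ℕ}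
    (hq : Even q) (hq0 : q ≠ 0) :
    ∑ i, (η * ((if i = n then 1 else 0) - (if i = m then 1 else 0))) ^ q * v i ≤
      η ^ q * (v m + v n) := by
  have hterm (i : Fin M) : (η * ((if i = n then 1 else 0) - (if i = m then 1 else 0))) ^ q * v i ≤
      η ^ q * ((if i = m then v i else 0) + (if i = n then v i else 0)) := by
    rw [mul_pow, mul_assoc]
    refine mul_le_mul_of_nonneg_left ?_ (hq.pow_nonneg η)
    have := hv i
    split_ifs <;> simp [hq0, hq.neg_pow, this]
  refine (Finset.sum_le_sum fun i _ => hterm i).trans_eq ?_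
  rw [← Finset.mul_sum, Finset.sum_add_distrib]
  simp

end StepDecomposition

section OneStep

variable {d : ℕ} {Z : Type*} [MeasurableSpace Z] {p : Params} {P : Problem d p.M Z} {xs : Space d}
  {η θ : ℝ} (ha : p.Admissible) (h : InClass p P xs) (hμH : p.μ ≤ p.H) (hη : 0 ≤ η)
  (hηH : η ≤ 1 / (2 * p.H)) (hθ : 0 < θ) (s : Fin p.M → Space d)
include ha h

theorem norm_meanDrift_le_of_inClass (hμH : p.μ ≤ p.H) (hη : 0 ≤ η) (hηH : η ≤ 1 / (2 * p.H)) :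
    ‖meanDrift P xs η s‖ ≤ (1 - η * p.μ) * ‖mean s - xs‖ + η * ‖gradBias P s‖ :=
  have : Nonempty (Fin p.M) := Fin.pos_iff_nonempty.1 ha.M_pos
  norm_meanDrift_le h.strongly_convex h.smooth_second ha.H_pos ha.μ_pos.le hμH hη hηH
    (mean_gradient_eq_zero ha.M_pos (fun m => (h.smooth_third m).1.differentiable two_ne_zero)
      h.optimum) s

include hμH hη hηH hθ

theorem hasMeanLE_norm_mean_localStep_sub_sq :
    HasMeanLE (Measure.pi P.D) (fun w => ‖mean (localStep P η s w) - xs‖ ^ 2)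
      ((1 + θ) * (1 - η * p.μ) ^ 2 * ‖mean s - xs‖ ^ 2 +
        (1 + 1 / θ) * η ^ 2 * (2 * p.τ ^ 2 * spread 2 s + 2 * p.Q ^ 2 * spread 4 s) +
        η ^ 2 * p.σ₂ ^ 2 / p.M) := by
  have : Nonempty (Fin p.M) := Fin.pos_iff_nonempty.1 ha.M_pos
  obtain ⟨s₂, s₄, hs₂, -, hN, -⟩ := exists_noiseBound h.oracle h.second_moment h.fourth_moment
  have hbias := norm_gradBias_sq_le ha.Q_nonneg h.smooth_third h.hessian_heterogeneity s
  have hvar : ∑ m, (-(η / (p.M : ℝ))) ^ 2 * s₂ m ^ 2 ≤ η ^ 2 * p.σ₂ ^ 2 / p.M := by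
    simpa only [pow_one] using sum_mean_weights_pow_le hη hs₂ even_two
  simp_rw [mean_localStep_sub]
  refine (hasMeanLE_norm_add_sum_noise_sq_of_norm_le h.oracle hN s hθ
    (norm_meanDrift_le_of_inClass ha h s hμH hη hηH) hvar).trans_le ?_
  rw [mul_pow, mul_pow, ← mul_assoc, ← mul_assoc]
  gcongr

theorem hasMeanLE_norm_mean_localStep_sub_pow_four :
    HasMeanLE (Measure.pi P.D) (fun w => ‖mean (localStep P η s w) - xs‖ ^ 4)
      ((1 + θ) ^ 4 * (1 - η * p.μ) ^ 4 * ‖mean s - xs‖ ^ 4 +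
        (1 + θ) * (1 + 1 / θ) ^ 3 * η ^ 4 * (p.H ^ 4 * spread 4 s) +
        ((16 / θ + 8) * (η ^ 2 * p.σ₂ ^ 2 / p.M) ^ 2 + 3 * (η ^ 4 * p.σ₄ ^ 4 / p.M ^ 3))) := by
  have : Nonempty (Fin p.M) := Fin.pos_iff_nonempty.1 ha.M_pos
  obtain ⟨s₂, s₄, hs₂, hs₄, hN, -⟩ := exists_noiseBound h.oracle h.second_moment h.fourth_moment
  have hbias := norm_gradBias_pow_four_le h.smooth_second s
  have hvar : ∑ m, (-(η / (p.M : ℝ))) ^ 2 * s₂ m ^ 2 ≤ η ^ 2 * p.σ₂ ^ 2 / p.M := by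
    simpa only [pow_one] using sum_mean_weights_pow_le hη hs₂ even_two
  have hfourth : ∑ m, (-(η / (p.M : ℝ))) ^ 4 * s₄ m ^ 4 ≤ η ^ 4 * p.σ₄ ^ 4 / p.M ^ 3 :=
    sum_mean_weights_pow_le hη hs₄ (by decide)
  simp_rw [mean_localStep_sub]
  refine (hasMeanLE_norm_add_sum_noise_pow_four_of_norm_le h.oracle hN s hθ
    (norm_meanDrift_le_of_inClass ha h s hμH hη hηH)
    (pow_le_pow_left₀ (by positivity) hvar 2) hfourth).trans_le ?_
  rw [mul_pow, mul_pow η, ← mul_assoc, ← mul_assoc (_ * _)]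
  gcongr

end OneStep

section PairStep

variable {d : ℕ} {Z : Type*} [MeasurableSpace Z] {p : Params} {P : Problem d p.M Z}
  {xs : Space d} {η θ : ℝ} (ha : p.Admissible) (h : InClass p P xs) (hμH : p.μ ≤ p.H)
  (hη : 0 ≤ η) (hηH : η ≤ 1 / (2 * p.H)) (hθ : 0 < θ) {xm : Fin p.M → Space d}
  (hxm : ∀ m, gradient (P.F m) (xm m) = 0) {s₂ s₄ : Fin p.M → ℝ}
  (s : Fin p.M → Space d) (m n : Fin p.M)
include ha h hμH hη hηH hxm

theorem norm_pairDrift_le_of_inClass :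
    ‖(s m - η • gradient (P.F m) (s m)) - (s n - η • gradient (P.F n) (s n))‖ ≤
      (1 - η * p.μ) * ‖s m - s n‖ + η * (p.H * ‖xm m - xm n‖ + p.τ * ‖xs - xm m‖ +
        p.τ * ‖mean s - xs‖ + p.τ * ‖s n - mean s‖) :=
  norm_pairDrift_le h.strongly_convex h.smooth_second (fun m => (h.smooth_third m).1)
    h.hessian_heterogeneity ha.H_pos ha.μ_pos.le hμH ha.τ_nonneg hη hηH hxm xs s m n

include hθ

theorem hasMeanLE_norm_localStep_sub_sq
    (hN : NoiseBound P (fun m => s₂ m ^ 2) (fun m => s₄ m ^ 4)) :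
    HasMeanLE (Measure.pi P.D) (fun w => ‖localStep P η s w m - localStep P η s w n‖ ^ 2)
      ((1 + θ) * (1 - η * p.μ) ^ 2 * ‖s m - s n‖ ^ 2 +
        (1 + 1 / θ) * η ^ 2 * 4 * (p.H ^ 2 * ‖xm m - xm n‖ ^ 2 + p.τ ^ 2 * ‖xs - xm m‖ ^ 2 +
          p.τ ^ 2 * ‖mean s - xs‖ ^ 2 + p.τ ^ 2 * ‖s n - mean s‖ ^ 2) +
        η ^ 2 * (s₂ m ^ 2 + s₂ n ^ 2)) := by
  simp_rw [localStep_sub]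
  refine (hasMeanLE_norm_add_sum_noise_sq_of_norm_le h.oracle hN s hθ
    (norm_pairDrift_le_of_inClass ha h hμH hη hηH hxm s m n) (sum_pair_weights_pow_le η m n
      (v := fun i => s₂ i ^ 2) (fun i => sq_nonneg _) even_two two_ne_zero)).trans_le ?_
  simp only [mul_pow, mul_assoc]
  gcongr
  exact (add_four_sq_le _ _ _ _).trans_eq (by ring)

theorem hasMeanLE_norm_localStep_sub_pow_four
    (hN : NoiseBound P (fun m => s₄ m ^ 2) (fun m => s₄ m ^ 4)) :
    HasMeanLE (Measure.pi P.D) (fun w => ‖localStep P η s w m - localStep P η s w n‖ ^ 4)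
      ((1 + θ) ^ 4 * (1 - η * p.μ) ^ 4 * ‖s m - s n‖ ^ 4 +
        (1 + θ) * (1 + 1 / θ) ^ 3 * η ^ 4 * 64 * (p.H ^ 4 * ‖xm m - xm n‖ ^ 4 +
          p.τ ^ 4 * ‖xs - xm m‖ ^ 4 + p.τ ^ 4 * ‖mean s - xs‖ ^ 4 +
          p.τ ^ 4 * ‖s n - mean s‖ ^ 4) +
        (32 / θ + 19) * η ^ 4 * (s₄ m ^ 4 + s₄ n ^ 4)) := by
  have hvar := sum_pair_weights_pow_le η m n (v := fun i => s₄ i ^ 2) (fun i => sq_nonneg _)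
    even_two two_ne_zero
  have hfourth := sum_pair_weights_pow_le η m n (v := fun i => s₄ i ^ 4) (fun i => by positivity)
    (by decide) four_ne_zero
  have hvar_sq : (η ^ 2 * (s₄ m ^ 2 + s₄ n ^ 2)) ^ 2 ≤ 2 * η ^ 4 * (s₄ m ^ 4 + s₄ n ^ 4) :=
    calc _ = η ^ 4 * (s₄ m ^ 2 + s₄ n ^ 2) ^ 2 := by ring
      _ ≤ η ^ 4 * (2 * ((s₄ m ^ 2) ^ 2 + (s₄ n ^ 2) ^ 2)) := by
        gcongr
        exact add_sq_le
      _ = _ := by ring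
  simp_rw [localStep_sub]
  refine (hasMeanLE_norm_add_sum_noise_pow_four_of_norm_le h.oracle hN s hθ
    (norm_pairDrift_le_of_inClass ha h hμH hη hηH hxm s m n)
    ((pow_le_pow_left₀ (Finset.sum_nonneg fun i _ => by positivity) hvar 2).trans hvar_sq)
    hfourth).trans_le (add_le_add (add_le_add (by rw [mul_pow, mul_assoc]) ?_) ?_)
  · simp only [mul_pow, mul_assoc]
    gcongr
    exact (add_four_pow_four_le _ _ _ _).trans_eq (by ring)
  · exact le_of_eq (by ring)

end PairStep

section SpreadStep

variable {d : ℕ} {Z : Type*} [MeasurableSpace Z] {p : Params} {P : Problem d p.M Z} {xs : Space d}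
  {η θ : ℝ}

theorem expect_sq_le_of_expect_pow_four_le {ι : Type*} [Fintype ι] [Nonempty ι] {f : ι → ℝ} {c : ℝ}
    (hf : 𝔼 i, f i ^ 4 ≤ c ^ 4) : 𝔼 i, f i ^ 2 ≤ c ^ 2 := by
  have hjensen := pow_expect_le (f := fun i => f i ^ 2) (fun i => sq_nonneg _) 2
  simp only [← pow_mul] at hjensen
  exact (abs_le_of_sq_le_sq' ((hjensen.trans hf).trans_eq (by ring)) (sq_nonneg _)).2

theorem spread_two_le_of_spread_four_le {ι E : Type*} [Fintype ι] [Nonempty ι]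
    [NormedAddCommGroup E] {s : ι → E} {c : ℝ} (hs : spread 4 s ≤ c ^ 4) : spread 2 s ≤ c ^ 2 := by
  have hpairs (q : ℕ) : spread q s = 𝔼 ij : ι × ι, ‖s ij.1 - s ij.2‖ ^ q := by
    rw [spread, ← Finset.univ_product_univ, Finset.expect_product]
  rw [hpairs] at hs ⊢
  exact expect_sq_le_of_expect_pow_four_le hs

theorem InClass.exists_minimizers (hμ : 0 < p.μ) (h : InClass p P xs) :
    ∃ xm : Fin p.M → Space d, (∀ m, gradient (P.F m) (xm m) = 0) ∧ spread 4 xm ≤ p.ζ ^ 4 ∧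
      𝔼 m, ‖xs - xm m‖ ^ 4 ≤ p.φ ^ 4 := by
  choose xm hxm using fun m => IsStronglyConvex.exists_optima_eq_singleton hμ (h.strongly_convex m)
  refine ⟨xm, fun m => gradient_eq_zero_of_isMinOn_univ
    ((hxm m).symm ▸ Set.mem_singleton (xm m) : _ ∈ optima (P.F m)), ?_, ?_⟩
  · refine le_of_eq_of_le ?_ h.optima_discrepancy
    simp only [spread, zetaPair_eq hxm, Fintype.expect_eq_sum_div_card, Fintype.card_fin,
      ← Finset.sum_div]
    ring
  · refine le_of_eq_of_le ?_ h.avg_optima_discrepancy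
    simp only [hxm, Metric.infDist_singleton, dist_eq_norm, Fintype.expect_eq_sum_div_card,
      Fintype.card_fin]
    ring

variable (ha : p.Admissible) (h : InClass p P xs) (hμH : p.μ ≤ p.H) (hη : 0 ≤ η)
  (hηH : η ≤ 1 / (2 * p.H)) (hθ : 0 < θ) (s : Fin p.M → Space d)
include ha h hμH hη hηH hθ

theorem hasMeanLE_spread_two_localStep :
    HasMeanLE (Measure.pi P.D) (fun w => spread 2 (localStep P η s w))
      ((1 + θ) * (1 - η * p.μ) ^ 2 * spread 2 s +
        (1 + 1 / θ) * η ^ 2 * 4 * (p.H ^ 2 * p.ζ ^ 2 + p.τ ^ 2 * p.φ ^ 2 +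
          p.τ ^ 2 * ‖mean s - xs‖ ^ 2 + p.τ ^ 2 * spread 2 s) +
        2 * η ^ 2 * p.σ₂ ^ 2) := by
  have : Nonempty (Fin p.M) := Fin.pos_iff_nonempty.1 ha.M_pos
  obtain ⟨s₂, s₄, hs₂, -, hN, -⟩ := exists_noiseBound h.oracle h.second_moment h.fourth_moment
  obtain ⟨xm, hxm, hζ, hφ⟩ := h.exists_minimizers ha.μ_pos
  have hζ₂ := spread_two_le_of_spread_four_le hζ
  have hφ₂ := expect_sq_le_of_expect_pow_four_le hφ
  have hdev := expect_norm_sub_mean_pow_le s 2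
  refine (HasMeanLE.expect fun m => HasMeanLE.expect fun n =>
    hasMeanLE_norm_localStep_sub_sq ha h hμH hη hηH hθ hxm s m n hN).trans_le ?_
  simp only [Finset.expect_add_distrib, ← Finset.mul_expect, Fintype.expect_const, ← two_mul]
  unfold spread at hζ₂ hdev ⊢
  rw [mul_comm 2 (η ^ 2), mul_assoc (η ^ 2)]
  gcongr

theorem hasMeanLE_spread_four_localStep :
    HasMeanLE (Measure.pi P.D) (fun w => spread 4 (localStep P η s w))
      ((1 + θ) ^ 4 * (1 - η * p.μ) ^ 4 * spread 4 s +
        (1 + θ) * (1 + 1 / θ) ^ 3 * η ^ 4 * 64 * (p.H ^ 4 * p.ζ ^ 4 + p.τ ^ 4 * p.φ ^ 4 +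
          p.τ ^ 4 * ‖mean s - xs‖ ^ 4 + p.τ ^ 4 * spread 4 s) +
        (32 / θ + 19) * η ^ 4 * (2 * p.σ₄ ^ 4)) := by
  have : Nonempty (Fin p.M) := Fin.pos_iff_nonempty.1 ha.M_pos
  obtain ⟨s₂, s₄, -, hs₄, -, hN⟩ := exists_noiseBound h.oracle h.second_moment h.fourth_moment
  obtain ⟨xm, hxm, hζ, hφ⟩ := h.exists_minimizers ha.μ_pos
  have hdev := expect_norm_sub_mean_pow_le s 4
  refine (HasMeanLE.expect fun m => HasMeanLE.expect fun n =>
    hasMeanLE_norm_localStep_sub_pow_four ha h hμH hη hηH hθ hxm s m n hN).trans_le ?_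
  simp only [Finset.expect_add_distrib, ← Finset.mul_expect, Fintype.expect_const, ← two_mul]
  unfold spread at hζ hdev ⊢
  gcongr

end SpreadStep

section YoungWeights

variable {θ ε : ℝ}

theorem one_add_inv_le (hθ : 0 < θ) (hθ1 : θ ≤ 1) : 1 + 1 / θ ≤ 2 / θ := by
  have : 1 ≤ 1 / θ := one_le_one_div hθ hθ1
  linarith [show 2 / θ = 1 / θ + 1 / θ by ring]

theorem one_add_mul_one_add_inv_pow_three_le (hθ : 0 < θ) (hθ1 : θ ≤ 1) :
    (1 + θ) * (1 + 1 / θ) ^ 3 ≤ 16 / θ ^ 3 :=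
  calc (1 + θ) * (1 + 1 / θ) ^ 3 ≤ (1 + 1) * (2 / θ) ^ 3 := by
        gcongr
        exact one_add_inv_le hθ hθ1
    _ = 16 / θ ^ 3 := by ring

theorem one_add_pow_four_mul_contraction_le (hθ : 0 ≤ θ) (hθ1 : θ ≤ 1) (hε : 0 ≤ ε) (hε1 : ε ≤ 1) :
    (1 + θ) ^ 4 * (1 - ε) ^ 4 ≤ (1 + 15 * θ) * (1 - ε) ^ 2 := by
  have hpow (k : ℕ) (hk : k ≠ 0) : θ ^ k ≤ θ := pow_le_of_le_one hθ hθ1 hk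
  have hbinomial : (1 + θ) ^ 4 ≤ 1 + 15 * θ :=
    calc (1 + θ) ^ 4 = 1 + 4 * θ + 6 * θ ^ 2 + 4 * θ ^ 3 + θ ^ 4 := by ring
      _ ≤ 1 + 15 * θ := by linarith [hpow 2 two_ne_zero, hpow 3 three_ne_zero, hpow 4 four_ne_zero]
  have hcontraction : (1 - ε) ^ 4 ≤ (1 - ε) ^ 2 :=
    pow_le_pow_of_le_one (by linarith) (by linarith) (by norm_num)
  gcongr

end YoungWeights

section Lyapunov

variable {d : ℕ}

/-- The Lyapunov function whose mean at the last step is the total error. -/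
def modelError (p : Params) (xs : Space d) (s : Fin p.M → Space d) : ℝ :=
  ‖mean s - xs‖ ^ 2 + 1 / p.B ^ 2 * ‖mean s - xs‖ ^ 4

/-- The combination of the second and fourth moments of the spread of the local models that drives
the model error; the powers of `Λ` offset those lost to Young's inequality with weight `ημ/Λ`. -/
def consensusError (p : Params) (Λ : ℝ) (s : Fin p.M → Space d) : ℝ :=
  Λ * (p.τ ^ 2 / p.μ ^ 2) * spread 2 s + Λ ^ 3 * (p.κ' / p.B ^ 2) * spread 4 s

/-- Heterogeneity and noise added during a round to the second moment of the spread; the factor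
`log K` makes it vanish when the models are averaged at every step. -/
def spreadTwoSource (p : Params) (η : ℝ) : ℝ :=
  (p.K * η) ^ 2 * (p.H ^ 2 * p.ζ ^ 2 + p.τ ^ 2 * p.φ ^ 2) +
    2 * Real.log p.K * (p.K * η ^ 2 * p.σ₂ ^ 2)

/-- Heterogeneity and noise added during a round to the fourth moment of the spread. -/
def spreadFourSource (p : Params) (η : ℝ) : ℝ :=
  (p.K * η) ^ 4 * (p.H ^ 4 * p.ζ ^ 4 + p.τ ^ 4 * p.φ ^ 4) +
    2 * Real.log p.K * (p.K ^ 2 * η ^ 4 * p.σ₄ ^ 4)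

/-- Heterogeneity and noise added during a round to the consensus error. -/
def consensusSource (p : Params) (η Λ : ℝ) : ℝ :=
  8 * (Λ * (p.τ ^ 2 / p.μ ^ 2)) * spreadTwoSource p η +
    1024 * (Λ ^ 3 * (p.κ' / p.B ^ 2)) * spreadFourSource p η

/-- Noise added in one step to the model error. -/
def noiseSource (p : Params) (η Λ : ℝ) : ℝ :=
  η ^ 2 * p.σ₂ ^ 2 / p.M + 1 / p.B ^ 2 *
    ((16 * Λ / p.μ * η ^ 3 + 8 * η ^ 4) * (p.σ₂ ^ 2 / p.M) ^ 2 + 3 * (η ^ 4 * p.σ₄ ^ 4 / p.M ^ 3))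

variable {p : Params}

theorem Params.Admissible.two_le_κ' (ha : p.Admissible) : 2 ≤ p.κ' := by
  have := ha.μ_pos
  rw [Params.κ', add_assoc]
  exact le_add_of_nonneg_right (by positivity)

theorem Params.Admissible.τ_sq_div_μ_sq_le_κ' (ha : p.Admissible) : p.τ ^ 2 / p.μ ^ 2 ≤ p.κ' := by
  have hμ := ha.μ_pos
  have hτH : p.τ ^ 2 / p.μ ^ 2 ≤ 4 * (p.H ^ 2 / p.μ ^ 2) := by
    rw [← mul_div_assoc]
    gcongr
    exact (pow_le_pow_left₀ ha.τ_nonneg ha.τ_le 2).trans_eq (by ring)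
  have hQ : 0 ≤ 4 * p.Q ^ 2 * p.B ^ 2 / p.μ ^ 2 := by positivity
  have hH : 6 * p.H ^ 4 / p.μ ^ 4 = 6 * (p.H ^ 2 / p.μ ^ 2) ^ 2 := by ring
  rw [Params.κ', hH]
  nlinarith [sq_nonneg (p.H ^ 2 / p.μ ^ 2 - 1 / 2)]

theorem Params.Admissible.smoothness_le_κ' (ha : p.Admissible) {Λ : ℝ} (hΛ : 1 ≤ Λ) :
    Λ * (p.Q ^ 2 / p.μ ^ 2) + 1 / p.B ^ 2 * (Λ ^ 3 * (p.H ^ 4 / p.μ ^ 4)) ≤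
      Λ ^ 3 * (p.κ' / p.B ^ 2) := by
  have hμ := ha.μ_pos
  have hB := ha.B_pos
  have hΛ3 : Λ ≤ Λ ^ 3 := le_self_pow₀ hΛ (by norm_num)
  have hκ' : p.κ' / p.B ^ 2 = (2 / p.B ^ 2 + 3 * (p.Q ^ 2 / p.μ ^ 2) +
      5 * (1 / p.B ^ 2 * (p.H ^ 4 / p.μ ^ 4))) +
      (p.Q ^ 2 / p.μ ^ 2 + 1 / p.B ^ 2 * (p.H ^ 4 / p.μ ^ 4)) := by
    unfold Params.κ'
    field_simp
    ring
  calc Λ * (p.Q ^ 2 / p.μ ^ 2) + 1 / p.B ^ 2 * (Λ ^ 3 * (p.H ^ 4 / p.μ ^ 4))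
      ≤ Λ ^ 3 * (p.Q ^ 2 / p.μ ^ 2) + 1 / p.B ^ 2 * (Λ ^ 3 * (p.H ^ 4 / p.μ ^ 4)) := by gcongr
    _ = Λ ^ 3 * (p.Q ^ 2 / p.μ ^ 2 + 1 / p.B ^ 2 * (p.H ^ 4 / p.μ ^ 4)) := by ring
    _ ≤ Λ ^ 3 * (p.κ' / p.B ^ 2) := by
      gcongr
      rw [hκ']
      exact le_add_of_nonneg_left (by positivity)

theorem Params.Admissible.mul_μ_le_half (ha : p.Admissible) (hμH : p.μ ≤ p.H) {η : ℝ}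
    (hηH : η ≤ 1 / (2 * p.H)) : η * p.μ ≤ 1 / 2 := by
  have hH := ha.H_pos
  have hμ := ha.μ_pos
  calc η * p.μ ≤ 1 / (2 * p.H) * p.H := by gcongr
    _ = 1 / 2 := by field_simp

theorem Params.Admissible.consensusSource_nonneg (ha : p.Admissible) {η Λ : ℝ} (hΛ : 0 ≤ Λ) :
    0 ≤ consensusSource p η Λ := by
  have := ha.two_le_κ'
  have : 0 ≤ Real.log p.K := Real.log_natCast_nonneg _
  unfold consensusSource spreadTwoSource spreadFourSource
  positivity

section Coupling

variable {η Λ : ℝ} (ha : p.Admissible) (hΛ : 1 ≤ Λ)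
  (hκ : p.κ' * (p.K * η * p.τ) ^ 2 * Λ ^ 2 ≤ 1)
include ha hΛ hκ

theorem Params.Admissible.coupling_sq_le_half : (p.K * η * p.τ) ^ 2 ≤ 1 / 2 := by
  have hκ' := ha.two_le_κ'
  have hstep : 2 * (p.K * η * p.τ) ^ 2 ≤ 1 :=
    calc 2 * (p.K * η * p.τ) ^ 2 ≤ p.κ' * (p.K * η * p.τ) ^ 2 := by gcongr
      _ ≤ p.κ' * (p.K * η * p.τ) ^ 2 * Λ ^ 2 :=
        le_mul_of_one_le_right (by positivity) (one_le_pow₀ hΛ)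
      _ ≤ 1 := hκ
  linarith

theorem Params.Admissible.two_coupling_le :
    Λ * (p.τ ^ 2 / p.μ ^ 2) * (p.K * η * p.τ) ^ 2 ≤ 1 / Λ := by
  have hΛ0 : 0 < Λ := by linarith
  rw [le_div_iff₀ hΛ0]
  calc Λ * (p.τ ^ 2 / p.μ ^ 2) * (p.K * η * p.τ) ^ 2 * Λ
      ≤ Λ * p.κ' * (p.K * η * p.τ) ^ 2 * Λ := by
        gcongr
        exact ha.τ_sq_div_μ_sq_le_κ'
    _ = p.κ' * (p.K * η * p.τ) ^ 2 * Λ ^ 2 := by ring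
    _ ≤ 1 := hκ

theorem Params.Admissible.four_coupling_le :
    Λ ^ 3 * p.κ' * (p.K * η * p.τ) ^ 4 ≤ 1 / Λ := by
  have hΛ0 : 0 < Λ := by linarith
  have hκ' := ha.two_le_κ'
  rw [le_div_iff₀ hΛ0]
  calc Λ ^ 3 * p.κ' * (p.K * η * p.τ) ^ 4 * Λ
      ≤ p.κ' * (Λ ^ 3 * p.κ' * (p.K * η * p.τ) ^ 4 * Λ) :=
        le_mul_of_one_le_left (by positivity) (by linarith)
    _ = (p.κ' * (p.K * η * p.τ) ^ 2 * Λ ^ 2) ^ 2 := by ring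
    _ ≤ 1 := pow_le_one₀ (by positivity) hκ

end Coupling

end Lyapunov

section ModelErrorStep

variable {d : ℕ} {Z : Type*} [MeasurableSpace Z] {p : Params} {P : Problem d p.M Z} {xs : Space d}
  {η Λ : ℝ} (ha : p.Admissible) (h : InClass p P xs) (hμH : p.μ ≤ p.H) (hη : 0 < η)
  (hηH : η ≤ 1 / (2 * p.H)) (hΛ : 1 ≤ Λ) (s : Fin p.M → Space d)
include ha h hμH hη hηH hΛ

theorem hasMeanLE_norm_mean_localStep_sub_sq_of_one_le :
    HasMeanLE (Measure.pi P.D) (fun w => ‖mean (localStep P η s w) - xs‖ ^ 2)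
      ((1 + 15 * (η * p.μ / Λ)) * (1 - η * p.μ) ^ 2 * ‖mean s - xs‖ ^ 2 +
        16 * (η * p.μ) * (Λ * (p.τ ^ 2 / p.μ ^ 2) * spread 2 s +
          Λ * (p.Q ^ 2 / p.μ ^ 2) * spread 4 s) + η ^ 2 * p.σ₂ ^ 2 / p.M) := by
  have hμ := ha.μ_pos
  have hΛ0 : 0 < Λ := by linarith
  have hθ : 0 < η * p.μ / Λ := by positivity
  have hθ1 : η * p.μ / Λ ≤ 1 := by
    rw [div_le_one hΛ0]
    linarith [ha.mul_μ_le_half hμH hηH]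
  have hS := spread_nonneg 2 s
  have hT := spread_nonneg 4 s
  refine (hasMeanLE_norm_mean_localStep_sub_sq ha h hμH hη.le hηH hθ s).trans_le ?_
  gcongr ?_ * _ * _ + ?_ + _
  · linarith
  · calc (1 + 1 / (η * p.μ / Λ)) * η ^ 2 * (2 * p.τ ^ 2 * spread 2 s + 2 * p.Q ^ 2 * spread 4 s)
        ≤ 2 / (η * p.μ / Λ) * η ^ 2 * (2 * p.τ ^ 2 * spread 2 s + 2 * p.Q ^ 2 * spread 4 s) := by
          gcongr
          exact one_add_inv_le hθ hθ1
      _ = 4 * (η * p.μ) * (Λ * (p.τ ^ 2 / p.μ ^ 2) * spread 2 s +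
          Λ * (p.Q ^ 2 / p.μ ^ 2) * spread 4 s) := by
          field_simp
          ring
      _ ≤ _ := by
          gcongr
          norm_num

theorem hasMeanLE_norm_mean_localStep_sub_pow_four_of_one_le :
    HasMeanLE (Measure.pi P.D) (fun w => ‖mean (localStep P η s w) - xs‖ ^ 4)
      ((1 + 15 * (η * p.μ / Λ)) * (1 - η * p.μ) ^ 2 * ‖mean s - xs‖ ^ 4 +
        16 * (η * p.μ) * (Λ ^ 3 * (p.H ^ 4 / p.μ ^ 4) * spread 4 s) +
        ((16 * Λ / p.μ * η ^ 3 + 8 * η ^ 4) * (p.σ₂ ^ 2 / p.M) ^ 2 +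
          3 * (η ^ 4 * p.σ₄ ^ 4 / p.M ^ 3))) := by
  have hμ := ha.μ_pos
  have hΛ0 : 0 < Λ := by linarith
  have hημ := ha.mul_μ_le_half hμH hηH
  have hθ : 0 < η * p.μ / Λ := by positivity
  have hθ1 : η * p.μ / Λ ≤ 1 := by
    rw [div_le_one hΛ0]
    linarith
  have hT := spread_nonneg 4 s
  refine (hasMeanLE_norm_mean_localStep_sub_pow_four ha h hμH hη.le hηH hθ s).trans_le ?_
  gcongr ?_ * _ + ?_ + (?_ + _)
  · exact one_add_pow_four_mul_contraction_le hθ.le hθ1 (by positivity) (by linarith)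
  · calc (1 + η * p.μ / Λ) * (1 + 1 / (η * p.μ / Λ)) ^ 3 * η ^ 4 * (p.H ^ 4 * spread 4 s)
        ≤ 16 / (η * p.μ / Λ) ^ 3 * η ^ 4 * (p.H ^ 4 * spread 4 s) := by
          gcongr
          exact one_add_mul_one_add_inv_pow_three_le hθ hθ1
      _ = _ := by field_simp
  · exact le_of_eq (by field_simp)

theorem hasMeanLE_modelError_localStep :
    HasMeanLE (Measure.pi P.D) (fun w => modelError p xs (localStep P η s w))
      ((1 + 15 * (η * p.μ / Λ)) * (1 - η * p.μ) ^ 2 * modelError p xs s +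
        16 * (η * p.μ) * consensusError p Λ s + noiseSource p η Λ) := by
  have hμ := ha.μ_pos
  have hT := spread_nonneg 4 s
  refine ((hasMeanLE_norm_mean_localStep_sub_sq_of_one_le ha h hμH hη hηH hΛ s).add
    ((hasMeanLE_norm_mean_localStep_sub_pow_four_of_one_le ha h hμH hη hηH hΛ s).const_mul
      (c := 1 / p.B ^ 2) (by positivity))).trans_le ?_
  calc _ = (1 + 15 * (η * p.μ / Λ)) * (1 - η * p.μ) ^ 2 * modelError p xs s +
        16 * (η * p.μ) * (Λ * (p.τ ^ 2 / p.μ ^ 2) * spread 2 s +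
          (Λ * (p.Q ^ 2 / p.μ ^ 2) + 1 / p.B ^ 2 * (Λ ^ 3 * (p.H ^ 4 / p.μ ^ 4))) * spread 4 s) +
        noiseSource p η Λ := by
        rw [modelError, noiseSource]
        ring
    _ ≤ _ := by
        unfold consensusError
        gcongr
        exact ha.smoothness_le_κ' hΛ

end ModelErrorStep

section ConsensusErrorStep

theorem one_le_two_mul_log {K : ℕ} (hK : 2 ≤ K) : 1 ≤ 2 * Real.log K := by
  have hlog : Real.log 2 ≤ Real.log K := Real.log_le_log two_pos (by exact_mod_cast hK)
  linarith [Real.log_two_gt_d9]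

theorem sq_le_two_mul_contraction {x ε : ℝ} (hx : x ^ 2 ≤ 1 / 2) (hε : ε ≤ 1 / 2) :
    x ^ 2 ≤ 2 * (1 - ε) ^ 2 := by
  nlinarith

theorem pow_four_le_contraction {x ε : ℝ} (hx : x ^ 2 ≤ 1 / 2) (hε : ε ≤ 1 / 2) :
    x ^ 4 ≤ (1 - ε) ^ 2 :=
  calc x ^ 4 = x ^ 2 * x ^ 2 := by ring
    _ ≤ 1 / 2 * (2 * (1 - ε) ^ 2) := by
      gcongr
      exact sq_le_two_mul_contraction hx hε
    _ = (1 - ε) ^ 2 := by ring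

variable {d : ℕ} {Z : Type*} [MeasurableSpace Z] {p : Params} {P : Problem d p.M Z} {xs : Space d}
  {η Λ : ℝ} (ha : p.Admissible) (h : InClass p P xs) (hμH : p.μ ≤ p.H) (hη : 0 < η)
  (hηH : η ≤ 1 / (2 * p.H)) (hK : 2 ≤ p.K) (s : Fin p.M → Space d)
include ha h hμH hη hηH hK

section Coupling

variable (hτ : (p.K * η * p.τ) ^ 2 ≤ 1 / 2)
include hτ

theorem hasMeanLE_spread_two_localStep_of_coupling :
    HasMeanLE (Measure.pi P.D) (fun w => spread 2 (localStep P η s w))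
      ((1 + 1040 / (p.K : ℝ)) * (1 - η * p.μ) ^ 2 * spread 2 s +
        8 / p.K * ((p.K * η * p.τ) ^ 2 * ‖mean s - xs‖ ^ 2 + spreadTwoSource p η)) := by
  have hK0 : (0 : ℝ) < p.K := by exact_mod_cast ha.K_pos
  have hK1 : (1 : ℝ) / p.K ≤ 1 := (div_le_one hK0).2 (by exact_mod_cast ha.K_pos)
  have hθ : (0 : ℝ) < 1 / p.K := by positivity
  have hS := spread_nonneg 2 s
  have hcoupling : 8 / p.K * ((p.K * η * p.τ) ^ 2 * spread 2 s) ≤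
      8 / p.K * (2 * (1 - η * p.μ) ^ 2 * spread 2 s) := by
    gcongr ?_ * (?_ * ?_)
    exact sq_le_two_mul_contraction hτ (ha.mul_μ_le_half hμH hηH)
  have hnoise : 2 * η ^ 2 * p.σ₂ ^ 2 ≤
      8 / p.K * (2 * Real.log p.K * (p.K * η ^ 2 * p.σ₂ ^ 2)) :=
    calc 2 * η ^ 2 * p.σ₂ ^ 2 ≤ 8 * η ^ 2 * p.σ₂ ^ 2 * (2 * Real.log p.K) :=
          (le_mul_of_one_le_right (by positivity) (one_le_two_mul_log hK)).trans'
            (by gcongr; norm_num)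
      _ = _ := by field_simp
  have hYoung : (1 + 1 / (1 / (p.K : ℝ))) * η ^ 2 * 4 * (p.H ^ 2 * p.ζ ^ 2 + p.τ ^ 2 * p.φ ^ 2 +
        p.τ ^ 2 * ‖mean s - xs‖ ^ 2 + p.τ ^ 2 * spread 2 s) ≤
      8 / p.K * ((p.K * η) ^ 2 * (p.H ^ 2 * p.ζ ^ 2 + p.τ ^ 2 * p.φ ^ 2) +
        (p.K * η * p.τ) ^ 2 * ‖mean s - xs‖ ^ 2 + (p.K * η * p.τ) ^ 2 * spread 2 s) :=
    (mul_le_mul_of_nonneg_right (mul_le_mul_of_nonneg_right (mul_le_mul_of_nonneg_right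
      (one_add_inv_le hθ hK1) (by positivity)) (by positivity)) (by positivity)).trans_eq
      (by field_simp; ring)
  refine (hasMeanLE_spread_two_localStep ha h hμH hη.le hηH hθ s).trans_le ?_
  have hslack : 0 ≤ 1023 / p.K * (1 - η * p.μ) ^ 2 * spread 2 s := by positivity
  rw [spreadTwoSource]
  linear_combination hYoung + hcoupling + hnoise + hslack

theorem hasMeanLE_spread_four_localStep_of_coupling :
    HasMeanLE (Measure.pi P.D) (fun w => spread 4 (localStep P η s w))
      ((1 + 1040 / (p.K : ℝ)) * (1 - η * p.μ) ^ 2 * spread 4 s +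
        1024 / p.K * ((p.K * η * p.τ) ^ 4 * ‖mean s - xs‖ ^ 4 + spreadFourSource p η)) := by
  have hμ := ha.μ_pos
  have hK2 : (2 : ℝ) ≤ p.K := by exact_mod_cast hK
  have hK0 : (0 : ℝ) < p.K := by linarith
  have hK1 : (1 : ℝ) / p.K ≤ 1 := (div_le_one hK0).2 (by exact_mod_cast ha.K_pos)
  have hθ : (0 : ℝ) < 1 / p.K := by positivity
  have hημ := ha.mul_μ_le_half hμH hηH
  have hT := spread_nonneg 4 s
  have hcoupling : 1024 / p.K * ((p.K * η * p.τ) ^ 4 * spread 4 s) ≤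
      1024 / p.K * ((1 - η * p.μ) ^ 2 * spread 4 s) := by
    gcongr ?_ * (?_ * ?_)
    exact pow_four_le_contraction hτ hημ
  have hnoise : (32 / (1 / (p.K : ℝ)) + 19) * η ^ 4 * (2 * p.σ₄ ^ 4) ≤
      1024 / p.K * (2 * Real.log p.K * (p.K ^ 2 * η ^ 4 * p.σ₄ ^ 4)) :=
    calc (32 / (1 / (p.K : ℝ)) + 19) * η ^ 4 * (2 * p.σ₄ ^ 4)
        ≤ (512 * p.K) * η ^ 4 * (2 * p.σ₄ ^ 4) * (2 * Real.log p.K) := by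
          refine (le_mul_of_one_le_right (by positivity) (one_le_two_mul_log hK)).trans' ?_
          gcongr
          rw [div_div_eq_mul_div, div_one]
          linarith
      _ = _ := by field_simp; ring
  have hYoung : (1 + 1 / (p.K : ℝ)) * (1 + 1 / (1 / (p.K : ℝ))) ^ 3 * η ^ 4 * 64 *
        (p.H ^ 4 * p.ζ ^ 4 + p.τ ^ 4 * p.φ ^ 4 + p.τ ^ 4 * ‖mean s - xs‖ ^ 4 +
          p.τ ^ 4 * spread 4 s) ≤
      1024 / p.K * ((p.K * η) ^ 4 * (p.H ^ 4 * p.ζ ^ 4 + p.τ ^ 4 * p.φ ^ 4) +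
        (p.K * η * p.τ) ^ 4 * ‖mean s - xs‖ ^ 4 + (p.K * η * p.τ) ^ 4 * spread 4 s) :=
    (mul_le_mul_of_nonneg_right (mul_le_mul_of_nonneg_right (mul_le_mul_of_nonneg_right
      (one_add_mul_one_add_inv_pow_three_le hθ hK1) (by positivity)) (by positivity))
      (by positivity)).trans_eq (by field_simp; ring)
  have hYoung_contraction := mul_le_mul_of_nonneg_right
    (one_add_pow_four_mul_contraction_le hθ.le hK1 (by positivity : 0 ≤ η * p.μ) (by linarith)) hT
  refine (hasMeanLE_spread_four_localStep ha h hμH hη.le hηH hθ s).trans_le ?_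
  -- The growth rate `1040` rounds up `15 + 1024`, from `hYoung_contraction` and `hcoupling`.
  have hslack : 0 ≤ 1 / p.K * (1 - η * p.μ) ^ 2 * spread 4 s := by positivity
  rw [spreadFourSource]
  linear_combination hYoung_contraction + hYoung + hcoupling + hnoise + hslack

end Coupling

variable (hΛ : 1 ≤ Λ) (hκ : p.κ' * (p.K * η * p.τ) ^ 2 * Λ ^ 2 ≤ 1)
include hΛ hκ

theorem hasMeanLE_consensusError_localStep :
    HasMeanLE (Measure.pi P.D) (fun w => consensusError p Λ (localStep P η s w))
      ((1 + 1040 / (p.K : ℝ)) * (1 - η * p.μ) ^ 2 * consensusError p Λ s +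
        1040 / p.K * (modelError p xs s / Λ + consensusSource p η Λ)) := by
  have hμ := ha.μ_pos
  have hΛ0 : 0 < Λ := by linarith
  have hκ' := ha.two_le_κ'
  have hτ := ha.coupling_sq_le_half hΛ hκ
  have hsource := ha.consensusSource_nonneg (η := η) hΛ0.le
  refine (((hasMeanLE_spread_two_localStep_of_coupling ha h hμH hη hηH hK s hτ).const_mul
    (c := Λ * (p.τ ^ 2 / p.μ ^ 2)) (by positivity)).add
    ((hasMeanLE_spread_four_localStep_of_coupling ha h hμH hη hηH hK s hτ).const_mul
      (c := Λ ^ 3 * (p.κ' / p.B ^ 2)) (by positivity))).trans_le ?_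
  have htwo : 8 / p.K * (Λ * (p.τ ^ 2 / p.μ ^ 2) * (p.K * η * p.τ) ^ 2 * ‖mean s - xs‖ ^ 2) ≤
      1040 / p.K * (1 / Λ * ‖mean s - xs‖ ^ 2) := by
    gcongr ?_ / _ * (?_ * _)
    · norm_num
    · exact ha.two_coupling_le hΛ hκ
  have hfour : 1024 / p.K *
        (Λ ^ 3 * p.κ' * (p.K * η * p.τ) ^ 4 * (1 / p.B ^ 2 * ‖mean s - xs‖ ^ 4)) ≤
      1040 / p.K * (1 / Λ * (1 / p.B ^ 2 * ‖mean s - xs‖ ^ 4)) := by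
    gcongr ?_ / _ * (?_ * _)
    · norm_num
    · exact ha.four_coupling_le hΛ hκ
  have hsource_scale : 1 / p.K * consensusSource p η Λ ≤ 1040 / p.K * consensusSource p η Λ := by
    gcongr
    norm_num
  rw [consensusError, modelError]
  rw [consensusSource] at hsource_scale ⊢
  linear_combination htwo + hfour + hsource_scale

end ConsensusErrorStep

section CoupledRecursion

theorem one_add_pow_le_exp {x : ℝ} (hx : 0 ≤ x) {n : ℕ} {y : ℝ} (hxy : n * x ≤ y) :
    (1 + x) ^ n ≤ Real.exp y :=
  calc (1 + x) ^ n ≤ Real.exp x ^ n := by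
        gcongr
        linarith [Real.add_one_le_exp x]
    _ = Real.exp (n * x) := (Real.exp_nat_mul x n).symm
    _ ≤ Real.exp y := Real.exp_le_exp.2 hxy

theorem add_one_mod_of_ne_zero {K t : ℕ} (hK : 0 < K) (ht : (t + 1) % K ≠ 0) :
    (t + 1) % K = t % K + 1 := by
  have hlt := Nat.mod_lt t hK
  have hne : t % K + 1 ≠ K := fun heq => ht (by rw [← Nat.mod_add_mod, heq, Nat.mod_self])
  rw [← Nat.mod_add_mod, Nat.mod_eq_of_lt (by omega)]

variable {r ε Λ c G N u : ℝ}

theorem modelError_recursion_le {C φ ψ : ℝ} (hr : 1 / 4 ≤ r) (hε : 0 ≤ ε) (hΛ : 0 < Λ)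
    (hC : 0 ≤ C) (hu : 0 ≤ u) (hφ : φ ≤ u) (hψ : ψ ≤ 4 * C * (u / Λ + G)) :
    (1 + 15 * (ε / Λ)) * r * φ + 16 * ε * ψ + N ≤
      (1 + (15 + 256 * C) * (ε / Λ)) * r * u + (64 * C * ε * G + N) := by
  have hslow : ε / Λ * u ≤ 4 * r * (ε / Λ * u) :=
    le_mul_of_one_le_left (by positivity) (by linarith)
  calc (1 + 15 * (ε / Λ)) * r * φ + 16 * ε * ψ + N
      ≤ (1 + 15 * (ε / Λ)) * r * u + 16 * ε * (4 * C * (u / Λ + G)) + N := by gcongr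
    _ = (1 + 15 * (ε / Λ)) * r * u + 64 * C * (ε / Λ * u) + (64 * C * ε * G + N) := by ring
    _ ≤ (1 + 15 * (ε / Λ)) * r * u + 64 * C * (4 * r * (ε / Λ * u)) + (64 * C * ε * G + N) := by
      gcongr
    _ = (1 + (15 + 256 * C) * (ε / Λ)) * r * u + (64 * C * ε * G + N) := by ring

theorem consensusError_recursion_le {a q u' φ ψ : ℝ} (hr : 1 / 4 ≤ r) (hr1 : r ≤ 1) (hΛ : 0 < Λ)
    (ha : 0 ≤ a) (hu : 0 ≤ u) (hG : 0 ≤ G) (hq : 1 ≤ q) (hφ : φ ≤ u)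
    (hψ : ψ ≤ 4 * (q - 1) * (u / Λ + G)) (hu' : r * u ≤ u') :
    (1 + a) * r * ψ + a * (φ / Λ + G) ≤ 4 * (q * (1 + a) - 1) * (u' / Λ + G) := by
  have : 0 ≤ q - 1 := by linarith
  have hV : 0 ≤ u / Λ + G := by positivity
  have hdecay : r * (u / Λ + G) ≤ u' / Λ + G :=
    calc r * (u / Λ + G) = r * u / Λ + r * G := by ring
      _ ≤ u' / Λ + G := by
        gcongr
        exact mul_le_of_le_one_left hG hr1
  calc (1 + a) * r * ψ + a * (φ / Λ + G)
      ≤ (1 + a) * r * (4 * (q - 1) * (u / Λ + G)) + a * (u / Λ + G) := by gcongr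
    _ = (1 + a) * (4 * (q - 1)) * (r * (u / Λ + G)) + a * (u / Λ + G) := by ring
    _ ≤ (1 + a) * (4 * (q - 1)) * (u' / Λ + G) + a * (4 * (u' / Λ + G)) := by
      gcongr ?_ + _ * ?_
      · exact mul_le_mul_of_nonneg_left hdecay (by positivity)
      · linarith [mul_le_mul_of_nonneg_right hr hV]
    _ = 4 * (q * (1 + a) - 1) * (u' / Λ + G) := by ring

variable {K : ℕ} {Φ Ψ U : ℕ → ℝ}

theorem le_supersolution_of_coupled_recursion (hK : 0 < K) (hr : 1 / 4 ≤ r) (hr1 : r ≤ 1)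
    (hε : 0 ≤ ε) (hΛ : 0 < Λ) (hc : 0 ≤ c) (hG : 0 ≤ G) (hN : 0 ≤ N) (hU : ∀ t, 0 ≤ U t)
    (hU_succ : ∀ t, (1 + (15 + 256 * Real.exp c) * (ε / Λ)) * r * U t +
      (64 * Real.exp c * ε * G + N) ≤ U (t + 1))
    (hΦ_zero : Φ 0 ≤ U 0) (hΨ_zero : Ψ 0 = 0)
    (hΦ : ∀ t, Φ (t + 1) ≤ (1 + 15 * (ε / Λ)) * r * Φ t + 16 * ε * Ψ t + N)
    (hsync : ∀ t, (t + 1) % K = 0 → Ψ (t + 1) = 0)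
    (hΨ : ∀ t, (t + 1) % K ≠ 0 → Ψ (t + 1) ≤ (1 + c / K) * r * Ψ t + c / K * (Φ t / Λ + G))
    (t : ℕ) : Φ t ≤ U t := by
  have hcK : 0 ≤ c / K := by positivity
  have hdecay (t : ℕ) : r * U t ≤ U (t + 1) := by
    refine le_trans ?_ (hU_succ t)
    have hgrowth : 0 ≤ (15 + 256 * Real.exp c) * (ε / Λ) * (r * U t) :=
      mul_nonneg (by positivity) (mul_nonneg (by linarith) (hU t))
    have hsource : 0 ≤ 64 * Real.exp c * ε * G := by positivity
    linarith
  suffices hinv : Φ t ≤ U t ∧ Ψ t ≤ 4 * ((1 + c / K) ^ (t % K) - 1) * (U t / Λ + G) from hinv.1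
  induction t with
  | zero => simp [hΦ_zero, hΨ_zero]
  | succ t ih =>
    obtain ⟨ihΦ, ihΨ⟩ := ih
    have hV : 0 ≤ U t / Λ + G := add_nonneg (div_nonneg (hU t) hΛ.le) hG
    have hround : (1 + c / K) ^ (t % K) ≤ Real.exp c := by
      refine one_add_pow_le_exp hcK ?_
      calc ((t % K : ℕ) : ℝ) * (c / K) ≤ K * (c / K) := by
            gcongr
            exact (Nat.mod_lt t hK).le
        _ = c := by field_simp
    refine ⟨((hΦ t).trans (modelError_recursion_le hr hε hΛ (Real.exp_pos c).le (hU t) ihΦ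
      (ihΨ.trans ?_))).trans (hU_succ t), ?_⟩
    · gcongr
      linarith
    by_cases ht : (t + 1) % K = 0
    · simp [hsync t ht, ht]
    · rw [add_one_mod_of_ne_zero hK ht, pow_succ]
      exact (hΨ t ht).trans (consensusError_recursion_le hr hr1 hΛ hcK (hU t) hG
        (one_le_pow₀ (by linarith)) ihΦ ihΨ (hdecay t))

theorem mul_linear_growth_add_le {α β X : ℝ} (hr1 : r ≤ 1) (hα : 0 ≤ α) (hβ : 0 ≤ β) (t : ℕ) :
    (1 + α) * r * ((1 + α) ^ t * (r ^ t * X + t * β)) + β ≤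
      (1 + α) ^ (t + 1) * (r ^ (t + 1) * X + (t + 1 : ℕ) * β) := by
  have hcontraction : r * ((1 + α) ^ (t + 1) * (t * β)) ≤ (1 + α) ^ (t + 1) * (t * β) :=
    mul_le_of_le_one_left (by positivity) hr1
  have hsource : β ≤ (1 + α) ^ (t + 1) * β :=
    le_mul_of_one_le_left hβ (one_le_pow₀ (by linarith))
  push_cast
  linear_combination hcontraction + hsource

theorem coupled_recursion_horizon_le {T : ℕ} {X : ℝ} (hK : 0 < K) (hε : 0 ≤ ε)
    (hε_half : ε ≤ 1 / 2) (hΛ : 0 < Λ) (hc : 0 ≤ c) (hG : 0 ≤ G) (hN : 0 ≤ N) (hX : 0 ≤ X)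
    (hT : ε * T ≤ Λ) (hΦ_zero : Φ 0 ≤ X) (hΨ_zero : Ψ 0 = 0)
    (hΦ : ∀ t, Φ (t + 1) ≤ (1 + 15 * (ε / Λ)) * (1 - ε) ^ 2 * Φ t + 16 * ε * Ψ t + N)
    (hsync : ∀ t, (t + 1) % K = 0 → Ψ (t + 1) = 0)
    (hΨ : ∀ t, (t + 1) % K ≠ 0 →
      Ψ (t + 1) ≤ (1 + c / K) * (1 - ε) ^ 2 * Ψ t + c / K * (Φ t / Λ + G)) :
    Φ T ≤ Real.exp (15 + 256 * Real.exp c) *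
      (Real.exp (-(2 * (ε * T))) * X + 64 * Real.exp c * (Λ * G) + T * N) := by
  have hr1 : (1 - ε) ^ 2 ≤ 1 := pow_le_one₀ (by linarith) (by linarith)
  have hα : 0 ≤ (15 + 256 * Real.exp c) * (ε / Λ) := by positivity
  have hsolution := le_supersolution_of_coupled_recursion hK (by nlinarith) hr1 hε hΛ hc hG hN
    (fun t => by positivity)
    (mul_linear_growth_add_le (X := X) hr1 hα (by positivity))
    (by simpa using hΦ_zero) hΨ_zero hΦ hsync hΨ T
  have hgrowth :
      (1 + (15 + 256 * Real.exp c) * (ε / Λ)) ^ T ≤ Real.exp (15 + 256 * Real.exp c) := by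
    refine one_add_pow_le_exp hα ?_
    calc T * ((15 + 256 * Real.exp c) * (ε / Λ)) = (15 + 256 * Real.exp c) * (ε * T / Λ) := by ring
      _ ≤ 15 + 256 * Real.exp c :=
        mul_le_of_le_one_right (by positivity) ((div_le_one hΛ).2 hT)
  have hdecay : ((1 - ε) ^ 2) ^ T ≤ Real.exp (-(2 * (ε * T))) :=
    calc ((1 - ε) ^ 2) ^ T = (1 - ε) ^ (2 * T) := (pow_mul _ _ _).symm
      _ ≤ Real.exp (-ε) ^ (2 * T) := by
        gcongr
        · linarith
        · linarith [Real.add_one_le_exp (-ε)]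
      _ = Real.exp (-(2 * (ε * T))) := by
        rw [← Real.exp_nat_mul]
        congr 1
        push_cast
        ring
  have hsources : T * (64 * Real.exp c * ε * G + N) ≤ 64 * Real.exp c * (Λ * G) + T * N :=
    calc T * (64 * Real.exp c * ε * G + N) = 64 * Real.exp c * ((ε * T) * G) + T * N := by ring
      _ ≤ 64 * Real.exp c * (Λ * G) + T * N := by gcongr
  rw [add_assoc]
  exact hsolution.trans (by gcongr)

end CoupledRecursion

section Expectation

theorem spread_const {ι E : Type*} [Fintype ι] [NormedAddCommGroup E] {q : ℕ} (hq : q ≠ 0) (x : E) :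
    spread q (fun _ : ι => x) = 0 := by
  simp [spread, hq]

variable {d : ℕ} {p : Params} {xs : Space d} {Λ : ℝ}

theorem measurable_spread {M : ℕ} (q : ℕ) :
    Measurable (spread q : (Fin M → Space d) → ℝ) := by
  unfold spread
  simp only [Fintype.expect_eq_sum_div_card]
  fun_prop

theorem measurable_modelError (p : Params) (xs : Space d) : Measurable (modelError p xs) := by
  have herror := (measurable_mean (M := p.M)).sub_const xs
  exact (herror.norm.pow_const 2).add ((herror.norm.pow_const 4).const_mul _)

theorem measurable_consensusError (p : Params) (Λ : ℝ) :
    Measurable (consensusError p Λ : (Fin p.M → Space d) → ℝ) :=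
  ((measurable_spread 2).const_mul _).add ((measurable_spread 4).const_mul _)

theorem modelError_nonneg (p : Params) (xs : Space d) : 0 ≤ modelError p xs :=
  fun s => by unfold modelError; positivity

theorem Params.Admissible.consensusError_nonneg (ha : p.Admissible) (hΛ : 0 ≤ Λ) :
    0 ≤ (consensusError p Λ : (Fin p.M → Space d) → ℝ) := fun s => by
  have hκ' := ha.two_le_κ'
  have hS := spread_nonneg 2 s
  have hT := spread_nonneg 4 s
  unfold consensusError
  positivity

theorem consensusError_const (p : Params) (Λ : ℝ) (x : Space d) :
    consensusError p Λ (fun _ => x) = 0 := by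
  simp [consensusError, spread_const]

theorem Params.Admissible.modelError_zero_le (ha : p.Admissible) (hxs : ‖xs‖ ≤ p.B) :
    modelError p xs (fun _ => 0) ≤ 2 * p.B ^ 2 := by
  have : Nonempty (Fin p.M) := Fin.pos_iff_nonempty.1 ha.M_pos
  have hB := ha.B_pos
  rw [modelError, mean_const, zero_sub, norm_neg]
  calc ‖xs‖ ^ 2 + 1 / p.B ^ 2 * ‖xs‖ ^ 4 ≤ p.B ^ 2 + 1 / p.B ^ 2 * p.B ^ 4 := by gcongr
    _ = 2 * p.B ^ 2 := by
      field_simp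
      ring

theorem Params.Admissible.noiseSource_nonneg (ha : p.Admissible) {η : ℝ} (hη : 0 ≤ η)
    (hΛ : 0 ≤ Λ) : 0 ≤ noiseSource p η Λ := by
  have := ha.μ_pos
  unfold noiseSource
  positivity

variable {Z Ω : Type*} [MeasurableSpace Z] {P : Problem d p.M Z} {z : ℕ → Fin p.M → Ω → Z} {η : ℝ}

/-- The random vector of local models of Local SGD at time `t`. -/
def state (P : Problem d p.M Z) (η : ℝ) (z : ℕ → Fin p.M → Ω → Z) (t : ℕ) (ω : Ω) :
    Fin p.M → Space d :=
  P.localIterate p.K η (fun t m => z t m ω) t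

theorem consensusError_state_succ_of_sync {t : ℕ} (ht : (t + 1) % p.K = 0) (ω : Ω) :
    consensusError p Λ (state P η z (t + 1) ω) = 0 := by
  rw [state, localIterate_succ, chainStep, if_pos ht]
  exact consensusError_const p Λ _

variable [MeasurableSpace Ω] {Pr : Measure Ω} [IsProbabilityMeasure Pr]
  (ha : p.Admissible) (h : InClass p P xs) (hz : IsSampling Pr P.D z) (hμH : p.μ ≤ p.H)
  (hη : 0 < η) (hηH : η ≤ 1 / (2 * p.H)) (hΛ : 1 ≤ Λ)
include ha h hz hμH hη hηH hΛ

theorem hasMeanLE_modelError_state_succ {t : ℕ}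
    (hmodel : Integrable (fun ω => modelError p xs (state P η z t ω)) Pr)
    (hconsensus : Integrable (fun ω => consensusError p Λ (state P η z t ω)) Pr) :
    HasMeanLE Pr (fun ω => modelError p xs (state P η z (t + 1) ω))
      ((1 + 15 * (η * p.μ / Λ)) * (1 - η * p.μ) ^ 2 * (∫ ω, modelError p xs (state P η z t ω) ∂Pr) +
        16 * (η * p.μ) * (∫ ω, consensusError p Λ (state P η z t ω) ∂Pr) + noiseSource p η Λ) := by
  have := fun m => (h.oracle m).1
  have hμ := ha.μ_pos
  refine hz.hasMeanLE_localIterate_succ (fun m => (h.oracle m).2.1) p.K η t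
    (measurable_modelError p xs) (modelError_nonneg p xs)
    (((measurable_modelError p xs).const_mul _).add
      ((measurable_consensusError p Λ).const_mul _) |>.add_const _) (fun s => ?_)
    (((hasMeanLE_integral hmodel).const_mul (by positivity)).add
      ((hasMeanLE_integral hconsensus).const_mul (by positivity)) |>.add (hasMeanLE_const _))
  simp only [modelError, mean_chainStep ha.M_pos]
  exact hasMeanLE_modelError_localStep ha h hμH hη hηH hΛ s

variable (hκ : p.κ' * (p.K * η * p.τ) ^ 2 * Λ ^ 2 ≤ 1)
include hκ

theorem hasMeanLE_consensusError_state_succ {t : ℕ} (ht : (t + 1) % p.K ≠ 0)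
    (hmodel : Integrable (fun ω => modelError p xs (state P η z t ω)) Pr)
    (hconsensus : Integrable (fun ω => consensusError p Λ (state P η z t ω)) Pr) :
    HasMeanLE Pr (fun ω => consensusError p Λ (state P η z (t + 1) ω))
      ((1 + 1040 / (p.K : ℝ)) * (1 - η * p.μ) ^ 2 *
          (∫ ω, consensusError p Λ (state P η z t ω) ∂Pr) +
        1040 / p.K * ((∫ ω, modelError p xs (state P η z t ω) ∂Pr) / Λ +
          consensusSource p η Λ)) := by
  have := fun m => (h.oracle m).1
  have hΛ0 : 0 < Λ := by linarith
  have hK : 2 ≤ p.K := by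
    have hK1 : p.K ≠ 1 := fun hK1 => ht (by rw [hK1, Nat.mod_one])
    have hK0 := ha.K_pos
    omega
  refine (hz.hasMeanLE_localIterate_succ (fun m => (h.oracle m).2.1) p.K η t
    (measurable_consensusError p Λ) (ha.consensusError_nonneg hΛ0.le)
    (((measurable_consensusError p Λ).const_mul _).add
      ((((measurable_modelError p xs).div_const Λ).add_const _).const_mul _)) (fun s => ?_)
    (((hasMeanLE_integral hconsensus).const_mul (by positivity)).add
      (((hasMeanLE_integral hmodel).div_const hΛ0.le |>.add (hasMeanLE_const _)).const_mul
        (by positivity))))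
  simp only [chainStep, if_neg ht]
  exact hasMeanLE_consensusError_localStep ha h hμH hη hηH hK s hΛ hκ

theorem integrable_modelError_and_consensusError_state (t : ℕ) :
    Integrable (fun ω => modelError p xs (state P η z t ω)) Pr ∧
      Integrable (fun ω => consensusError p Λ (state P η z t ω)) Pr := by
  induction t with
  | zero => exact ⟨integrable_const (modelError p xs fun _ => 0),
      integrable_const (consensusError p Λ fun _ => (0 : Space d))⟩
  | succ t ih =>
    refine ⟨(hasMeanLE_modelError_state_succ ha h hz hμH hη hηH hΛ ih.1 ih.2).1, ?_⟩
    by_cases ht : (t + 1) % p.K = 0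
    · simp only [consensusError_state_succ_of_sync ht]
      exact integrable_const 0
    · exact (hasMeanLE_consensusError_state_succ ha h hz hμH hη hηH hΛ hκ ht ih.1 ih.2).1

theorem memLp_finalError : MemLp (finalError p P xs η z) 4 Pr := by
  have hB := ha.B_pos
  have hfinal (ω : Ω) :
      finalError p P xs η z ω = mean (state P η z (p.K * p.R) ω) - xs := by
    rw [finalError, iterate_eq_mean, state]
  have hmeas : Measurable (finalError p P xs η z) := by
    simp only [funext hfinal]
    exact (measurable_mean.comp
      (hz.measurable_localIterate (fun m => (h.oracle m).2.1) p.K η _)).sub_const xs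
  have hdom : Integrable (fun ω => p.B ^ 2 * modelError p xs (state P η z (p.K * p.R) ω)) Pr :=
    (integrable_modelError_and_consensusError_state ha h hz hμH hη hηH hΛ hκ _).1.const_mul _
  have hfour : Integrable (fun ω => ‖finalError p P xs η z ω‖ ^ 4) Pr := by
    refine hdom.mono' (hmeas.norm.pow_const 4).aestronglyMeasurable (.of_forall fun ω => ?_)
    rw [Real.norm_of_nonneg (by positivity), hfinal, modelError, mul_add, ← mul_assoc,
      mul_one_div_cancel (by positivity), one_mul]
    exact le_add_of_nonneg_left (by positivity)
  refine (integrable_norm_rpow_iff hmeas.aestronglyMeasurable (by norm_num) (by norm_num)).1 ?_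
  simpa only [ENNReal.toReal_ofNat, Real.rpow_ofNat] using hfour

theorem totalError_eq_integral_modelError :
    totalError p P xs η Pr z = ∫ ω, modelError p xs (state P η z (p.K * p.R) ω) ∂Pr := by
  have hfour := memLp_finalError ha h hz hμH hη hηH hΛ hκ
  have htwo : MemLp (finalError p P xs η z) 2 Pr := hfour.mono_exponent (by norm_num)
  rw [totalError, ← integral_const_mul, ← integral_add (htwo.integrable_norm_pow two_ne_zero)
    ((hfour.integrable_norm_pow four_ne_zero).const_mul _)]
  simp only [modelError, finalError, iterate_eq_mean, state]

theorem totalError_le (hT : η * p.μ * p.K * p.R ≤ Λ) :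
    totalError p P xs η Pr z ≤ Real.exp (15 + 256 * Real.exp 1040) *
      (Real.exp (-(2 * (η * p.μ * p.K * p.R))) * (2 * p.B ^ 2) +
        64 * Real.exp 1040 * (Λ * consensusSource p η Λ) +
        p.K * p.R * noiseSource p η Λ) := by
  have hμ := ha.μ_pos
  have hΛ0 : 0 < Λ := by linarith
  have hint := integrable_modelError_and_consensusError_state ha h hz hμH hη hηH hΛ hκ
  have hsteps : η * p.μ * (p.K * p.R : ℕ) = η * p.μ * p.K * p.R := by
    push_cast
    ring
  have hhorizon := coupled_recursion_horizon_le (T := p.K * p.R) (X := 2 * p.B ^ 2) ha.K_pos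
    (Φ := fun t => ∫ ω, modelError p xs (state P η z t ω) ∂Pr)
    (Ψ := fun t => ∫ ω, consensusError p Λ (state P η z t ω) ∂Pr)
    (ε := η * p.μ) (c := 1040) (by positivity) (ha.mul_μ_le_half hμH hηH) hΛ0 (by norm_num)
    (ha.consensusSource_nonneg (η := η) hΛ0.le) (ha.noiseSource_nonneg hη.le hΛ0.le)
    (by positivity) (hsteps.trans_le hT)
    (by simpa only [state, Problem.localIterate, integral_const, probReal_univ, one_smul]
      using ha.modelError_zero_le h.bounded_optimum)
    (by simp only [state, Problem.localIterate, consensusError_const, integral_zero])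
    (fun t => (hasMeanLE_modelError_state_succ ha h hz hμH hη hηH hΛ (hint t).1 (hint t).2).2)
    (fun t ht => by simp only [consensusError_state_succ_of_sync ht, integral_zero])
    (fun t ht => (hasMeanLE_consensusError_state_succ ha h hz hμH hη hηH hΛ hκ ht
      (hint t).1 (hint t).2).2)
  rw [totalError_eq_integral_modelError ha h hz hμH hη hηH hΛ hκ]
  rwa [hsteps, Nat.cast_mul] at hhorizon

end Expectation

section Rate

theorem foldr_max_le_iff {α : Type*} [LinearOrder α] {l : List α} {a b : α} :
    l.foldr max a ≤ b ↔ a ≤ b ∧ ∀ x ∈ l, x ≤ b := by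
  induction l with
  | nil => simp
  | cons y l ih => simp only [List.foldr_cons, max_le_iff, ih, List.forall_mem_cons, and_left_comm]

variable {p : Params} {εt : ℝ}

theorem le_accuracy (p : Params) (εt : ℝ) : εt ≤ p.accuracy εt :=
  (foldr_max_le_iff.1 le_rfl).1

theorem le_accuracy_of_mem_rateTerms {x : ℝ} (hx : x ∈ p.rateTerms) : x ≤ p.accuracy εt :=
  (foldr_max_le_iff.1 le_rfl).2 x hx

theorem Params.Admissible.rateTerms_nonneg (ha : p.Admissible) : ∀ x ∈ p.rateTerms, 0 ≤ x := by
  have hμ := ha.μ_pos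
  have hκ' := ha.two_le_κ'
  have : 0 ≤ Real.log p.K := Real.log_natCast_nonneg _
  simp only [Params.rateTerms, List.forall_mem_cons, List.not_mem_nil, false_imp_iff, implies_true,
    and_true]
  refine ⟨?_, ?_, ?_, ?_, ?_, ?_, ?_, ?_, ?_, ?_, ?_, ?_, ?_, ?_⟩ <;> positivity

theorem Params.Admissible.le_rate_of_mem (ha : p.Admissible) {x : ℝ} (hx : x ∈ p.rateTerms) :
    x ≤ p.rate :=
  List.single_le_sum ha.rateTerms_nonneg x hx

theorem Params.Admissible.rate_nonneg (ha : p.Admissible) : 0 ≤ p.rate :=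
  List.sum_nonneg ha.rateTerms_nonneg

theorem Params.Admissible.accuracy_le_add_rate (ha : p.Admissible) {b : ℝ} (hb : 0 ≤ b)
    (hε : εt ≤ b + p.rate) : p.accuracy εt ≤ b + p.rate :=
  foldr_max_le_iff.2 ⟨hε, fun _ hx => (ha.le_rate_of_mem hx).trans (le_add_of_nonneg_left hb)⟩

theorem one_le_logFactor (p : Params) (εt : ℝ) : 1 ≤ p.logFactor εt := le_max_left _ _

end Rate

section Tuning

variable {p : Params} {η Λ : ℝ}

theorem Params.Admissible.κ'_mul_spreadTwoSource_le (ha : p.Admissible) (η : ℝ) :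
    p.κ' * spreadTwoSource p η ≤ 4 * (η * p.μ * p.K * p.R) ^ 2 * p.rate := by
  have hμ := ha.μ_pos
  have hK : (0 : ℝ) < p.K := by exact_mod_cast ha.K_pos
  have hR : (0 : ℝ) < p.R := by exact_mod_cast ha.R_pos
  have hφ : p.κ' * (p.τ ^ 2 * p.φ ^ 2 / (p.μ ^ 2 * p.R ^ 2)) ≤ p.rate :=
    ha.le_rate_of_mem (by simp [Params.rateTerms])
  have hζ : p.κ' * (p.H ^ 2 * p.ζ ^ 2 / (p.μ ^ 2 * p.R ^ 2)) ≤ p.rate :=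
    ha.le_rate_of_mem (by simp [Params.rateTerms])
  have hσ : p.κ' * (p.σ₂ ^ 2 * Real.log p.K / (p.μ ^ 2 * p.K * p.R ^ 2)) ≤ p.rate :=
    ha.le_rate_of_mem (by simp [Params.rateTerms])
  set e := η * p.μ * p.K * p.R with he
  calc p.κ' * spreadTwoSource p η
      = e ^ 2 * (p.κ' * (p.H ^ 2 * p.ζ ^ 2 / (p.μ ^ 2 * p.R ^ 2)) +
          p.κ' * (p.τ ^ 2 * p.φ ^ 2 / (p.μ ^ 2 * p.R ^ 2)) +
          2 * (p.κ' * (p.σ₂ ^ 2 * Real.log p.K / (p.μ ^ 2 * p.K * p.R ^ 2)))) := by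
        rw [he, spreadTwoSource]
        field_simp
    _ ≤ e ^ 2 * (p.rate + p.rate + 2 * p.rate) := by gcongr
    _ = 4 * e ^ 2 * p.rate := by ring

theorem Params.Admissible.κ'_div_mul_spreadFourSource_le (ha : p.Admissible) (η : ℝ) :
    p.κ' / p.B ^ 2 * spreadFourSource p η ≤ 4 * (η * p.μ * p.K * p.R) ^ 4 * p.rate := by
  have hμ := ha.μ_pos
  have hB := ha.B_pos
  have hK : (1 : ℝ) ≤ p.K := by exact_mod_cast ha.K_pos
  have hR : (1 : ℝ) ≤ p.R := by exact_mod_cast ha.R_pos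
  have hS := ha.rate_nonneg
  have hφ : p.κ' * (p.τ ^ 4 * p.φ ^ 4 / (p.μ ^ 4 * p.B ^ 2 * p.R ^ 4)) ≤ p.rate :=
    ha.le_rate_of_mem (by simp [Params.rateTerms])
  have hζ : p.κ' * (p.H ^ 4 * p.ζ ^ 4 / (p.μ ^ 4 * p.R ^ 3 * p.B ^ 2)) ≤ p.rate :=
    ha.le_rate_of_mem (by simp [Params.rateTerms])
  have hσ : p.κ' * (p.σ₄ ^ 4 * Real.log p.K / (p.μ ^ 4 * p.K * p.B ^ 2 * p.R ^ 4)) ≤ p.rate :=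
    ha.le_rate_of_mem (by simp [Params.rateTerms])
  set e := η * p.μ * p.K * p.R with he
  calc p.κ' / p.B ^ 2 * spreadFourSource p η
      = e ^ 4 * (p.κ' * (p.H ^ 4 * p.ζ ^ 4 / (p.μ ^ 4 * p.R ^ 3 * p.B ^ 2)) / p.R +
          p.κ' * (p.τ ^ 4 * p.φ ^ 4 / (p.μ ^ 4 * p.B ^ 2 * p.R ^ 4)) +
          2 * (p.κ' * (p.σ₄ ^ 4 * Real.log p.K / (p.μ ^ 4 * p.K * p.B ^ 2 * p.R ^ 4)) /
            p.K)) := by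
        rw [he, spreadFourSource]
        field_simp
    _ ≤ e ^ 4 * (p.rate / p.R + p.rate + 2 * (p.rate / p.K)) := by gcongr
    _ ≤ e ^ 4 * (p.rate + p.rate + 2 * p.rate) := by
        gcongr
        exacts [div_le_self hS hR, div_le_self hS hK]
    _ = 4 * e ^ 4 * p.rate := by ring

theorem Params.Admissible.consensusSource_le (ha : p.Admissible) (hη : 0 ≤ η) (hΛ : 1 ≤ Λ)
    (hT : η * p.μ * p.K * p.R ≤ Λ) : consensusSource p η Λ ≤ 4128 * Λ ^ 7 * p.rate := by
  have hμ := ha.μ_pos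
  have hS := ha.rate_nonneg
  have : 0 ≤ Real.log p.K := Real.log_natCast_nonneg _
  have htwo_nonneg : 0 ≤ spreadTwoSource p η := by unfold spreadTwoSource; positivity
  have htwo := ha.κ'_mul_spreadTwoSource_le η
  have hfour := ha.κ'_div_mul_spreadFourSource_le η
  calc consensusSource p η Λ
      = 8 * Λ * (p.τ ^ 2 / p.μ ^ 2 * spreadTwoSource p η) +
          1024 * Λ ^ 3 * (p.κ' / p.B ^ 2 * spreadFourSource p η) := by
        unfold consensusSource
        ring
    _ ≤ 8 * Λ * (p.κ' * spreadTwoSource p η) +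
          1024 * Λ ^ 3 * (p.κ' / p.B ^ 2 * spreadFourSource p η) := by
        gcongr
        exact ha.τ_sq_div_μ_sq_le_κ'
    _ ≤ 8 * Λ * (4 * (η * p.μ * p.K * p.R) ^ 2 * p.rate) +
          1024 * Λ ^ 3 * (4 * (η * p.μ * p.K * p.R) ^ 4 * p.rate) := by gcongr
    _ ≤ 8 * Λ * (4 * Λ ^ 2 * p.rate) + 1024 * Λ ^ 3 * (4 * Λ ^ 4 * p.rate) := by gcongr
    _ = 32 * Λ ^ 3 * p.rate + 4096 * Λ ^ 7 * p.rate := by ring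
    _ ≤ 32 * Λ ^ 7 * p.rate + 4096 * Λ ^ 7 * p.rate := by
        gcongr
        norm_num
    _ = 4128 * Λ ^ 7 * p.rate := by ring

theorem Params.Admissible.noiseSource_le (ha : p.Admissible) (hη : 0 ≤ η) (hΛ : 1 ≤ Λ)
    (hT : η * p.μ * p.K * p.R ≤ Λ)
    (hσ₂ : p.σ₂ ^ 2 / (p.μ ^ 2 * p.M * p.K * p.R) ≤ p.B ^ 2) :
    p.K * p.R * noiseSource p η Λ ≤ 28 * Λ ^ 4 * p.rate := by
  have hμ := ha.μ_pos
  have hB := ha.B_pos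
  have hM : (1 : ℝ) ≤ p.M := by exact_mod_cast ha.M_pos
  have hK : (1 : ℝ) ≤ p.K := by exact_mod_cast ha.K_pos
  have hR : (1 : ℝ) ≤ p.R := by exact_mod_cast ha.R_pos
  have hS := ha.rate_nonneg
  set second := p.σ₂ ^ 2 / (p.μ ^ 2 * p.M * p.K * p.R) with hsecond
  set fourth := p.σ₄ ^ 4 / (p.μ ^ 4 * p.K ^ 3 * p.R ^ 3 * p.M ^ 2 * p.B ^ 2) with hfourth
  have hsecond_le : second ≤ p.rate := ha.le_rate_of_mem (by simp [Params.rateTerms, hsecond])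
  have hfourth_le : fourth ≤ p.rate := ha.le_rate_of_mem (by simp [Params.rateTerms, hfourth])
  have hsquare_le : second ^ 2 / p.B ^ 2 ≤ p.rate := by
    refine le_trans ?_ hsecond_le
    rw [div_le_iff₀ (by positivity), sq]
    gcongr
  set e := η * p.μ * p.K * p.R with he
  have : 0 ≤ e := by positivity
  calc p.K * p.R * noiseSource p η Λ
      = e ^ 2 * second + 16 * Λ * e ^ 3 * (second ^ 2 / p.B ^ 2) +
          8 * e ^ 4 * (second ^ 2 / p.B ^ 2) / (p.K * p.R) + 3 * e ^ 4 * fourth / p.M := by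
        rw [he, hsecond, hfourth, noiseSource]
        field_simp
        ring
    _ ≤ e ^ 2 * second + 16 * Λ * e ^ 3 * (second ^ 2 / p.B ^ 2) +
          8 * e ^ 4 * (second ^ 2 / p.B ^ 2) + 3 * e ^ 4 * fourth := by
        gcongr
        exacts [div_le_self (by positivity) (one_le_mul_of_one_le_of_one_le hK hR),
          div_le_self (by positivity) hM]
    _ ≤ Λ ^ 2 * p.rate + 16 * Λ * Λ ^ 3 * p.rate + 8 * Λ ^ 4 * p.rate +
          3 * Λ ^ 4 * p.rate := by gcongr
    _ = Λ ^ 2 * p.rate + 27 * Λ ^ 4 * p.rate := by ring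
    _ ≤ Λ ^ 4 * p.rate + 27 * Λ ^ 4 * p.rate := by
        gcongr
        norm_num
    _ = 28 * Λ ^ 4 * p.rate := by ring

theorem Params.Admissible.coupling_le_one (ha : p.Admissible) (hη : 0 ≤ η) (hΛ : 0 ≤ Λ)
    (hT : η * p.μ * p.K * p.R ≤ Λ) (hR : p.τ * √p.κ' / p.μ * Λ ^ 2 ≤ p.R) :
    p.κ' * (p.K * η * p.τ) ^ 2 * Λ ^ 2 ≤ 1 := by
  have hμ := ha.μ_pos
  have hR0 : (0 : ℝ) < p.R := by exact_mod_cast ha.R_pos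
  have hτ := ha.τ_nonneg
  have hκ' : 0 ≤ p.κ' := zero_le_two.trans ha.two_le_κ'
  have hroot : √p.κ' * (p.K * η * p.τ) * Λ ≤ 1 :=
    calc √p.κ' * (p.K * η * p.τ) * Λ
        = p.τ * √p.κ' / p.μ * (η * p.μ * p.K * p.R) * Λ / p.R := by field_simp
      _ ≤ p.τ * √p.κ' / p.μ * Λ * Λ / p.R := by gcongr
      _ = p.τ * √p.κ' / p.μ * Λ ^ 2 / p.R := by ring
      _ ≤ 1 := (div_le_one hR0).2 hR
  calc p.κ' * (p.K * η * p.τ) ^ 2 * Λ ^ 2 = (√p.κ' * (p.K * η * p.τ) * Λ) ^ 2 := by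
        rw [mul_pow _ Λ, mul_pow √p.κ', Real.sq_sqrt hκ']
    _ ≤ 1 := pow_le_one₀ (by positivity) hroot

theorem Params.Admissible.exists_step_sources_le (ha : p.Admissible) (c : ℝ) :
    ∃ η : ℝ, 0 < η ∧ η ≤ 1 / (2 * p.H) ∧ η * p.μ * p.K * p.R ≤ 1 ∧
      c * consensusSource p η 1 + p.K * p.R * noiseSource p η 1 ≤ p.B ^ 2 := by
  have hH := ha.H_pos
  have hB := ha.B_pos
  have hsmall {f : ℝ → ℝ} {b : ℝ} (hf : Continuous f) (hf0 : f 0 = 0) (hb : 0 < b) :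
      ∀ᶠ η in 𝓝[>] 0, f η ≤ b :=
    ((hf.tendsto' 0 0 hf0).mono_left nhdsWithin_le_nhds).eventually_le_const hb
  have hpos : ∀ᶠ η : ℝ in 𝓝[>] 0, 0 < η := eventually_mem_nhdsWithin
  have hsources := hsmall (b := p.B ^ 2)
    (f := fun η => c * consensusSource p η 1 + p.K * p.R * noiseSource p η 1)
    (by unfold consensusSource spreadTwoSource spreadFourSource noiseSource; fun_prop)
    (by simp [consensusSource, spreadTwoSource, spreadFourSource, noiseSource]) (by positivity)
  have hhorizon := hsmall (f := fun η => η * p.μ * p.K * p.R) (by fun_prop) (by simp) one_pos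
  have hsmooth := hsmall continuous_id rfl (b := 1 / (2 * p.H)) (by positivity)
  exact (hpos.and (hsmooth.and (hhorizon.and hsources))).exists

end Tuning

section TunedStep

variable {p : Params} {εt : ℝ}

theorem accuracy_pos (hε : 0 < εt) : 0 < p.accuracy εt := hε.trans_le (le_accuracy p εt)

theorem accuracy_lt_sq_of_exp_mul_lt (hε : 0 < εt)
    (hB : Real.exp 1 * p.accuracy εt < p.B ^ 2) : p.accuracy εt < p.B ^ 2 :=
  (le_mul_of_one_le_left (accuracy_pos hε).le (Real.one_le_exp zero_le_one)).trans_lt hB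

theorem Params.Admissible.tunedStep_pos (ha : p.Admissible) (hε : 0 < εt)
    (hB : p.accuracy εt < p.B ^ 2) : 0 < p.tunedStep εt := by
  have hμ := ha.μ_pos
  have hH := ha.H_pos
  have hK : (0 : ℝ) < p.K := by exact_mod_cast ha.K_pos
  have hR : (0 : ℝ) < p.R := by exact_mod_cast ha.R_pos
  have hlog : 0 < Real.log (p.B ^ 2 / p.accuracy εt) :=
    Real.log_pos ((one_lt_div (accuracy_pos hε)).2 hB)
  exact lt_min (by positivity) (by positivity)

theorem Params.Admissible.tunedStep_mul_le_logFactor (ha : p.Admissible) (εt : ℝ) :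
    p.tunedStep εt * p.μ * p.K * p.R ≤ p.logFactor εt := by
  have hμ := ha.μ_pos
  have hK : (0 : ℝ) < p.K := by exact_mod_cast ha.K_pos
  have hR : (0 : ℝ) < p.R := by exact_mod_cast ha.R_pos
  calc p.tunedStep εt * p.μ * p.K * p.R
      ≤ 1 / (p.μ * p.K * p.R) * Real.log (p.B ^ 2 / p.accuracy εt) * p.μ * p.K * p.R := by
        gcongr
        exact min_le_right _ _
    _ = Real.log (p.B ^ 2 / p.accuracy εt) := by field_simp
    _ ≤ p.logFactor εt := le_max_right _ _

theorem exp_neg_two_mul_le {e : ℝ} (he : 0 ≤ e) : Real.exp (-(2 * e)) ≤ Real.exp (-e) :=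
  Real.exp_le_exp.2 (by linarith)

theorem Params.Admissible.exp_neg_two_mul_tunedStep_le (ha : p.Admissible) (hε : 0 < εt)
    (hB : p.accuracy εt < p.B ^ 2) :
    Real.exp (-(2 * (p.tunedStep εt * p.μ * p.K * p.R))) * p.B ^ 2 ≤
      max (Real.exp (-(p.K * p.R / p.κ)) * p.B ^ 2) (p.accuracy εt) := by
  have hμ := ha.μ_pos
  have := ha.H_pos
  have hB0 := ha.B_pos
  have hK : (0 : ℝ) < p.K := by exact_mod_cast ha.K_pos
  have hR : (0 : ℝ) < p.R := by exact_mod_cast ha.R_pos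
  have hacc := accuracy_pos (p := p) hε
  have hη := ha.tunedStep_pos hε hB
  rcases min_choice (1 / (2 * p.H))
    (1 / (p.μ * p.K * p.R) * Real.log (p.B ^ 2 / p.accuracy εt)) with hmin | hmin
  · refine le_max_of_le_left (le_of_eq ?_)
    rw [Params.tunedStep, hmin, Params.κ]
    field_simp
  · refine le_max_of_le_right ?_
    have hhorizon : p.tunedStep εt * p.μ * p.K * p.R = Real.log (p.B ^ 2 / p.accuracy εt) := by
      rw [Params.tunedStep, hmin]
      field_simp
    calc Real.exp (-(2 * (p.tunedStep εt * p.μ * p.K * p.R))) * p.B ^ 2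
        ≤ Real.exp (-(p.tunedStep εt * p.μ * p.K * p.R)) * p.B ^ 2 := by
          gcongr ?_ * _
          exact exp_neg_two_mul_le (by positivity)
      _ = p.accuracy εt := by
          rw [hhorizon, Real.exp_neg, Real.exp_log (by positivity)]
          field_simp

end TunedStep

section StepSize

/-- The constant in front of the rate; its exponentials come from iterating the coupled recursion
over a horizon of length `Λ`. -/
def rateConst : ℝ := Real.exp (15 + 256 * Real.exp 1040) * (30 + 264192 * Real.exp 1040)

theorem rateConst_pos : 0 < rateConst := by
  unfold rateConst
  positivity

variable {p : Params} {d : ℕ} {Z : Type*} [MeasurableSpace Z] {P : Problem d p.M Z}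
  {xs : Space d} {Ω : Type*} [MeasurableSpace Ω] {Pr : Measure Ω}
  {z : ℕ → Fin p.M → Ω → Z} {εt η Λ : ℝ}

theorem totalError_le_rate [IsProbabilityMeasure Pr] (ha : p.Admissible) (h : InClass p P xs)
    (hz : IsSampling Pr P.D z) (hμH : p.μ ≤ p.H) (hη : 0 < η) (hηH : η ≤ 1 / (2 * p.H))
    (hΛ : 1 ≤ Λ) (hκ : p.κ' * (p.K * η * p.τ) ^ 2 * Λ ^ 2 ≤ 1)
    (hT : η * p.μ * p.K * p.R ≤ Λ)
    (hσ₂ : p.σ₂ ^ 2 / (p.μ ^ 2 * p.M * p.K * p.R) ≤ p.B ^ 2) :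
    totalError p P xs η Pr z ≤ rateConst * Λ ^ 8 *
      (Real.exp (-(2 * (η * p.μ * p.K * p.R))) * p.B ^ 2 + p.rate) := by
  have hconsensus := ha.consensusSource_le hη.le hΛ hT
  have hnoise := ha.noiseSource_le hη.le hΛ hT hσ₂
  have hrate := ha.rate_nonneg
  set decay := Real.exp (-(2 * (η * p.μ * p.K * p.R))) * p.B ^ 2 with hdecay
  have hdecay_nonneg : 0 ≤ decay := by positivity
  have hdecay_le : decay ≤ Λ ^ 8 * decay :=
    le_mul_of_one_le_left hdecay_nonneg (one_le_pow₀ hΛ)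
  have hpow : Λ ^ 4 * p.rate ≤ Λ ^ 8 * p.rate := by
    gcongr
    norm_num
  have hbracket : Real.exp (-(2 * (η * p.μ * p.K * p.R))) * (2 * p.B ^ 2) +
      64 * Real.exp 1040 * (Λ * consensusSource p η Λ) + p.K * p.R * noiseSource p η Λ ≤
      (30 + 264192 * Real.exp 1040) * (Λ ^ 8 * (decay + p.rate)) :=
    calc _ ≤ 2 * decay + 64 * Real.exp 1040 * (Λ * (4128 * Λ ^ 7 * p.rate)) +
          28 * Λ ^ 4 * p.rate := by
          rw [mul_left_comm, ← hdecay]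
          gcongr
      _ = 2 * decay + 264192 * Real.exp 1040 * (Λ ^ 8 * p.rate) + 28 * (Λ ^ 4 * p.rate) := by
          ring
      _ ≤ 2 * (Λ ^ 8 * decay) + 264192 * Real.exp 1040 * (Λ ^ 8 * p.rate) +
          28 * (Λ ^ 8 * p.rate) := by gcongr
      _ ≤ (30 + 264192 * Real.exp 1040) * (Λ ^ 8 * (decay + p.rate)) := by
          have : 0 ≤ Real.exp 1040 * (Λ ^ 8 * decay) := by positivity
          have : 0 ≤ Λ ^ 8 * p.rate := by positivity
          linarith
  calc totalError p P xs η Pr z ≤ _ := totalError_le ha h hz hμH hη hηH hΛ hκ hT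
    _ ≤ Real.exp (15 + 256 * Real.exp 1040) *
        ((30 + 264192 * Real.exp 1040) * (Λ ^ 8 * (decay + p.rate))) := by gcongr
    _ = rateConst * Λ ^ 8 * (decay + p.rate) := by
      rw [rateConst]
      ring

theorem totalError_le_of_sources_le [IsProbabilityMeasure Pr] (ha : p.Admissible)
    (h : InClass p P xs) (hz : IsSampling Pr P.D z) (hμH : p.μ ≤ p.H) (hη : 0 < η)
    (hηH : η ≤ 1 / (2 * p.H)) (hκ : p.κ' * (p.K * η * p.τ) ^ 2 ≤ 1)
    (hT : η * p.μ * p.K * p.R ≤ 1)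
    (hsources : 64 * Real.exp 1040 * consensusSource p η 1 +
      p.K * p.R * noiseSource p η 1 ≤ p.B ^ 2) :
    totalError p P xs η Pr z ≤ rateConst * p.B ^ 2 := by
  have hμ := ha.μ_pos
  have hdecay : Real.exp (-(2 * (η * p.μ * p.K * p.R))) ≤ 1 :=
    Real.exp_le_one_iff.2 (neg_nonpos.2 (by positivity))
  have hinitial : Real.exp (-(2 * (η * p.μ * p.K * p.R))) * (2 * p.B ^ 2) ≤ 2 * p.B ^ 2 :=
    mul_le_of_le_one_left (by positivity) hdecay
  calc totalError p P xs η Pr z ≤ _ :=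
        totalError_le ha h hz hμH hη hηH le_rfl (by simpa using hκ) hT
    _ ≤ Real.exp (15 + 256 * Real.exp 1040) *
        ((30 + 264192 * Real.exp 1040) * p.B ^ 2) := by
      gcongr
      have : 0 ≤ Real.exp 1040 * p.B ^ 2 := by positivity
      linarith [sq_nonneg p.B]
    _ = rateConst * p.B ^ 2 := by rw [rateConst, mul_assoc]

/-- The conclusions drawn about a run of Local SGD with step size `η`. -/
def FinalBounds (p : Params) (εt : ℝ) (P : Problem d p.M Z) (xs : Space d) (η : ℝ)
    (Pr : Measure Ω) (z : ℕ → Fin p.M → Ω → Z) : Prop :=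
  MemLp (finalError p P xs η z) 4 Pr ∧
    totalError p P xs η Pr z ≤ 3 * rateConst * p.logFactor εt ^ 8 *
      (Real.exp (-(η * p.μ * p.K * p.R)) * p.B ^ 2 + p.rate) ∧
    (εt ≤ Real.exp (-(p.K * p.R / p.κ)) * p.B ^ 2 + p.rate →
      totalError p P xs η Pr z ≤ 3 * rateConst * p.logFactor εt ^ 8 *
        (Real.exp (-(p.K * p.R / p.κ)) * p.B ^ 2 + p.rate))

theorem finalBounds_of_totalError_le (ha : p.Admissible) {E : ℝ}
    (hmem : MemLp (finalError p P xs η z) 4 Pr)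
    (htotal : totalError p P xs η Pr z ≤ rateConst * p.logFactor εt ^ 8 * E)
    (hstep : E ≤ 3 * (Real.exp (-(η * p.μ * p.K * p.R)) * p.B ^ 2 + p.rate))
    (hbudget : p.accuracy εt ≤ Real.exp (-(p.K * p.R / p.κ)) * p.B ^ 2 + p.rate →
      E ≤ 3 * (Real.exp (-(p.K * p.R / p.κ)) * p.B ^ 2 + p.rate)) :
    FinalBounds p εt P xs η Pr z := by
  have hlift {b : ℝ} (hEb : E ≤ 3 * b) :
      totalError p P xs η Pr z ≤ 3 * rateConst * p.logFactor εt ^ 8 * b :=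
    calc totalError p P xs η Pr z ≤ rateConst * p.logFactor εt ^ 8 * E := htotal
      _ ≤ rateConst * p.logFactor εt ^ 8 * (3 * b) := by
        have := rateConst_pos
        gcongr
      _ = 3 * rateConst * p.logFactor εt ^ 8 * b := by ring
  exact ⟨hmem, hlift hstep,
    fun hε => hlift (hbudget (ha.accuracy_le_add_rate (by positivity) hε))⟩

theorem finalBounds_of_subsingleton [IsFiniteMeasure Pr] [Subsingleton (Space d)]
    (ha : p.Admissible) : FinalBounds p εt P xs η Pr z := by
  have hzero : finalError p P xs η z = fun _ => 0 := funext fun _ => Subsingleton.elim _ _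
  have hrate := ha.rate_nonneg
  refine finalBounds_of_totalError_le ha (E := 0) ?_ ?_ (by positivity) fun _ => by positivity
  · rw [hzero]
    exact memLp_const 0
  · simp [totalError, hzero]

theorem InClass.μ_le_H [Nontrivial (Space d)] (ha : p.Admissible) (h : InClass p P xs) :
    p.μ ≤ p.H :=
  IsStronglyConvex.le_of_isSmooth (h.strongly_convex ⟨0, ha.M_pos⟩) (h.smooth_second ⟨0, ha.M_pos⟩)

theorem finalBounds_of_μ_le_H_imp [IsFiniteMeasure Pr] (ha : p.Admissible) (h : InClass p P xs)
    (hbounds : p.μ ≤ p.H → FinalBounds p εt P xs η Pr z) : FinalBounds p εt P xs η Pr z := by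
  rcases subsingleton_or_nontrivial (Space d) with hd | hd
  · exact finalBounds_of_subsingleton ha
  · exact hbounds (h.μ_le_H ha)

variable [IsProbabilityMeasure Pr] (ha : p.Admissible) (h : InClass p P xs)
  (hz : IsSampling Pr P.D z) (hμH : p.μ ≤ p.H)
  (hR : p.τ * √p.κ' / p.μ * p.logFactor εt ^ 2 ≤ p.R)
include ha h hz hμH hR

theorem finalBounds_tunedStep (hε : 0 < εt) (hacc : p.accuracy εt < p.B ^ 2) :
    FinalBounds p εt P xs (p.tunedStep εt) Pr z := by
  have hη := ha.tunedStep_pos hε hacc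
  have hηH : p.tunedStep εt ≤ 1 / (2 * p.H) := min_le_left _ _
  have hΛ := one_le_logFactor p εt
  have hT := ha.tunedStep_mul_le_logFactor εt
  have hκ := ha.coupling_le_one hη.le (zero_le_one.trans hΛ) hT hR
  have hσ₂ : p.σ₂ ^ 2 / (p.μ ^ 2 * p.M * p.K * p.R) ≤ p.B ^ 2 :=
    (le_accuracy_of_mem_rateTerms (by simp [Params.rateTerms])).trans hacc.le
  have hrate := ha.rate_nonneg
  have hμ := ha.μ_pos
  refine finalBounds_of_totalError_le ha (memLp_finalError ha h hz hμH hη hηH hΛ hκ)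
    (totalError_le_rate ha h hz hμH hη hηH hΛ hκ hT hσ₂) ?_ fun hacc_le => ?_
  · have hdecay : Real.exp (-(2 * (p.tunedStep εt * p.μ * p.K * p.R))) * p.B ^ 2 ≤
        Real.exp (-(p.tunedStep εt * p.μ * p.K * p.R)) * p.B ^ 2 := by
      gcongr ?_ * _
      exact exp_neg_two_mul_le (by positivity)
    have : 0 ≤ Real.exp (-(p.tunedStep εt * p.μ * p.K * p.R)) * p.B ^ 2 := by positivity
    linarith
  · have hdecay := (ha.exp_neg_two_mul_tunedStep_le hε hacc).trans
      (max_le (le_add_of_nonneg_right hrate) hacc_le)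
    have : 0 ≤ Real.exp (-(p.K * p.R / p.κ)) * p.B ^ 2 := by positivity
    linarith

theorem finalBounds_of_sources_le (hη : 0 < η) (hηH : η ≤ 1 / (2 * p.H))
    (hT : η * p.μ * p.K * p.R ≤ 1)
    (hsources : 64 * Real.exp 1040 * consensusSource p η 1 +
      p.K * p.R * noiseSource p η 1 ≤ p.B ^ 2)
    (hB : p.B ^ 2 ≤ Real.exp 1 * p.accuracy εt) : FinalBounds p εt P xs η Pr z := by
  have hμ := ha.μ_pos
  have hτ := ha.τ_nonneg
  have hrate := ha.rate_nonneg
  have hrateConst := rateConst_pos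
  have hexp_one : Real.exp 1 ≤ 3 := Real.exp_one_lt_three.le
  have hΛ := one_le_logFactor p εt
  have hR_one : p.τ * √p.κ' / p.μ * 1 ^ 2 ≤ p.R := le_trans (by gcongr) hR
  have hκ := ha.coupling_le_one hη.le zero_le_one hT hR_one
  refine finalBounds_of_totalError_le ha (E := p.B ^ 2)
    (memLp_finalError ha h hz hμH hη hηH le_rfl hκ) ?_ ?_ fun hacc_le => ?_
  · calc totalError p P xs η Pr z ≤ rateConst * p.B ^ 2 :=
          totalError_le_of_sources_le ha h hz hμH hη hηH (by simpa using hκ) hT hsources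
      _ ≤ rateConst * p.logFactor εt ^ 8 * p.B ^ 2 := by
        gcongr
        exact le_mul_of_one_le_right hrateConst.le (one_le_pow₀ hΛ)
  · have hdecay : 1 ≤ 3 * Real.exp (-(η * p.μ * p.K * p.R)) :=
      calc 1 = Real.exp (η * p.μ * p.K * p.R) * Real.exp (-(η * p.μ * p.K * p.R)) := by
            rw [← Real.exp_add, add_neg_cancel, Real.exp_zero]
        _ ≤ 3 * Real.exp (-(η * p.μ * p.K * p.R)) := by
          gcongr
          exact (Real.exp_le_exp.2 hT).trans hexp_one
    calc p.B ^ 2 ≤ 3 * Real.exp (-(η * p.μ * p.K * p.R)) * p.B ^ 2 :=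
          le_mul_of_one_le_left (sq_nonneg _) hdecay
      _ ≤ 3 * (Real.exp (-(η * p.μ * p.K * p.R)) * p.B ^ 2 + p.rate) := by linarith
  · calc p.B ^ 2 ≤ Real.exp 1 * p.accuracy εt := hB
      _ ≤ Real.exp 1 * (Real.exp (-(p.K * p.R / p.κ)) * p.B ^ 2 + p.rate) := by gcongr
      _ ≤ 3 * (Real.exp (-(p.K * p.R / p.κ)) * p.B ^ 2 + p.rate) := by gcongr

end StepSize

end LocalSGD

end

open LocalSGD in
theorem mainTheorem5 :
    ∃ (C : ℝ) (q : ℕ), 0 < C ∧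
      ∀ (p : Params) (εt : ℝ), p.Admissible → 0 < εt →
        p.τ * Real.sqrt p.κ' / p.μ * p.logFactor εt ^ 2 ≤ (p.R : ℝ) →
        ∃ η : ℝ, 0 < η ∧ η ≤ 1 / (2 * p.H) ∧
          (Real.exp 1 * p.accuracy εt < p.B ^ 2 → η = p.tunedStep εt) ∧
          ∀ (d : ℕ) (Z : Type*) [MeasurableSpace Z] (P : Problem d p.M Z) (xs : Space d)
            (Ω : Type*) [MeasurableSpace Ω] (Pr : MeasureTheory.Measure Ω)
            [MeasureTheory.IsProbabilityMeasure Pr] (z : ℕ → Fin p.M → Ω → Z),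
            InClass p P xs → IsSampling Pr P.D z →
            MeasureTheory.MemLp (finalError p P xs η z) 4 Pr ∧
            totalError p P xs η Pr z ≤ C * p.logFactor εt ^ q *
              (Real.exp (-(η * p.μ * p.K * p.R)) * p.B ^ 2 + p.rate) ∧
            (εt ≤ Real.exp (-(p.K * p.R / p.κ)) * p.B ^ 2 + p.rate →
              totalError p P xs η Pr z ≤ C * p.logFactor εt ^ q *
                (Real.exp (-(p.K * p.R / p.κ)) * p.B ^ 2 + p.rate)) := by
  refine ⟨3 * rateConst, 8, mul_pos three_pos rateConst_pos, fun p εt ha hε hR => ?_⟩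
  by_cases hB : Real.exp 1 * p.accuracy εt < p.B ^ 2
  · have hacc := accuracy_lt_sq_of_exp_mul_lt hε hB
    refine ⟨p.tunedStep εt, ha.tunedStep_pos hε hacc, min_le_left _ _, fun _ => rfl,
      fun d Z _ P xs Ω _ Pr _ z h hz => ?_⟩
    exact finalBounds_of_μ_le_H_imp ha h fun hμH =>
      finalBounds_tunedStep ha h hz hμH hR hε hacc
  · obtain ⟨η, hη, hηH, hT, hsources⟩ := ha.exists_step_sources_le (64 * Real.exp 1040)
    refine ⟨η, hη, hηH, fun hB_lt => absurd hB_lt hB, fun d Z _ P xs Ω _ Pr _ z h hz => ?_⟩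
    exact finalBounds_of_μ_le_H_imp ha h fun hμH =>
      finalBounds_of_sources_le ha h hz hμH hR hη hηH hT hsources (not_lt.1 hB)
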